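/- Consider the synchronous $\mathrm{KT}_1$ LOCAL model. The network is a finite connected undirected graph $G=(V,E)$ with $n=|V|\ge 1$ nodes and diameter $D$; the nodes have distinct IDs (natural numbers), and one node $s$ is designated as the source. Initially a node knows only its own ID, the IDs of its neighbours, and whether it is the source. All nodes start simultaneously; in each round every node may send a message of arbitrary size to each of its neighbours (possibly different messages, or none), receives the messages sent to it, and performs arbitrary local computation. A node may terminate (already at the start) with an output, after which it sends nothing. The round complexity is the number of rounds until all nodes have terminated, and the message complexity is the total number of messages sent by all nodes. There exist an absolute constant $C$ and a single deterministic algorithm in this model such that, for every such network, every assignment of distinct IDs and every source $s$, the algorithm constructs a BFS tree of $G$ rooted at $s$, that is, there is a spanning tree $B$ of $G$ with $\mathrm{dist}_B(s,v)=\mathrm{dist}_G(s,v)$ for all $v\in V$ such that every node outputs the ID of its parent in $B$ (none for $s$) and the set of the IDs of its children in $B$. The algorithm takes at most $C\,(D\log n+\log^2 n)$ rounds and sends at most $C\, n\log^2 n$ messages. -/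

import Mathlib

/-! Synchronous message passing in the KT1 LOCAL model, and BFS trees. -/

namespace KT1

/-- A deterministic, uniform algorithm of the synchronous KT1 LOCAL model in which every node ends
with an output in `Out`. Local computation and message size are unrestricted. -/
structure LocalAlgorithm (Out : Type) where
  /-- local states of a node -/
  State : Type
  /-- messages -/
  Msg : Type
  /-- the initial state, computed from the initial knowledge of a node: its own ID, the set of the
  IDs of its neighbours, and whether it is the designated source -/
  init : ℕ → Finset ℕ → Bool → State
  /-- the message (if any) that a node in the given state sends to its neighbour with the given
  ID -/
  send : State → ℕ → Option Msg
  /-- the new state, computed from the old one and from the messages received, each of them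
  labelled with the ID of its sender -/
  step : State → Set (ℕ × Msg) → State
  /-- `some o` means that the node has terminated with output `o` -/
  output : State → Option Out

namespace LocalAlgorithm

variable {Out : Type} {V : Type*}

/-- The message that `v` sends to its neighbour `w` when the states of the nodes are given by `c`;
a terminated node sends nothing. -/
def sent (A : LocalAlgorithm Out) (id : V → ℕ) (c : V → A.State) (v w : V) : Option A.Msg :=
  match A.output (c v) with
  | some _ => none
  | none => A.send (c v) (id w)

/-- The messages that `v` receives from its neighbours, labelled with the IDs of the senders. -/
def inbox (A : LocalAlgorithm Out) (G : SimpleGraph V) (id : V → ℕ) (c : V → A.State) (v : V) :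
    Set (ℕ × A.Msg) :=
  {p | ∃ w, G.Adj w v ∧ p.1 = id w ∧ A.sent id c w v = some p.2}

/-- One synchronous round: all nodes send, receive and compute. A terminated node keeps its state,
hence its output. -/
def round (A : LocalAlgorithm Out) (G : SimpleGraph V) (id : V → ℕ) (c : V → A.State) :
    V → A.State := fun v =>
  match A.output (c v) with
  | some _ => c v
  | none => A.step (c v) (A.inbox G id c v)

/-- The states of all nodes after `t` rounds of the execution on the graph `G` with IDs `id` and
source `s`. -/
def config [Fintype V] [DecidableEq V] (A : LocalAlgorithm Out) (G : SimpleGraph V)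
    [DecidableRel G.Adj] (id : V → ℕ) (s : V) : ℕ → V → A.State
  | 0 => fun v => A.init (id v) ((G.neighborFinset v).image id) (decide (v = s))
  | t + 1 => A.round G id (A.config G id s t)

/-- `o v` is the output of every node `v`, and all nodes have terminated within `T` rounds. -/
def FinishesWithin [Fintype V] [DecidableEq V] (A : LocalAlgorithm Out) (G : SimpleGraph V)
    [DecidableRel G.Adj] (id : V → ℕ) (s : V) (T : ℕ) (o : V → Out) : Prop :=
  ∀ v, A.output (A.config G id s T v) = some (o v)

/-- The number of messages sent by all nodes in the first `T` rounds. -/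
def messageCount [Fintype V] [DecidableEq V] (A : LocalAlgorithm Out) (G : SimpleGraph V)
    [DecidableRel G.Adj] (id : V → ℕ) (s : V) (T : ℕ) : ℕ :=
  ∑ t ∈ Finset.range T, (Finset.univ.filter fun e : V × V =>
    G.Adj e.1 e.2 ∧ (A.sent id (A.config G id s t) e.1 e.2).isSome = true).card

end LocalAlgorithm

/-- `B` is a breadth-first search tree of `G` with root `s`. -/
structure IsBFSTree {V : Type*} (G B : SimpleGraph V) (s : V) : Prop where
  le : B ≤ G
  isTree : B.IsTree
  dist_eq : ∀ v, B.dist s v = G.dist s v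

/-- `p` is the parent of `v` in the tree `B` rooted at `s`. -/
def IsParent {V : Type*} (B : SimpleGraph V) (s v p : V) : Prop :=
  B.Adj v p ∧ B.dist s v = B.dist s p + 1

/-- What a node outputs in a rooted tree construction: the ID of its parent (`none` for the root)
and the IDs of its children. -/
structure TreeOutput where
  parent : Option ℕ
  children : Finset ℕ

/-- The outputs `o` describe the tree `B` rooted at `s`: every node outputs exactly the ID of its
parent, if it has one, and the IDs of its children. -/
def Describes {V : Type*} (o : V → TreeOutput) (B : SimpleGraph V) (id : V → ℕ) (s : V) : Prop :=
  ∀ v, (∀ k, (o v).parent = some k ↔ ∃ p, IsParent B s v p ∧ id p = k) ∧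
    (∀ k, k ∈ (o v).children ↔ ∃ c, IsParent B s c v ∧ id c = k)

end KT1

/-! The algorithm builds a sparse subgraph by gossip, collects the whole topology at the source
along it, and sends the topology back over a BFS tree.

Gossip. In phase `i` every node that has not yet heard of all its neighbours opens a link labelled
`i` to one it has not heard of. IDs then travel along labels `i, …, 0` forwards and `0, …, i`
backwards. Hence `v` hears of an active `u` exactly when their link trees of level `i + 1` meet
(`Reach.up`). The ends of a new link had disjoint trees of level `i`, so trees double in size
(`IsGossip.two_pow_le_ncard`) and activity ends within `log₂ n` phases, that is O(log² n) rounds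
with O(n) gossip messages each. At most `n log₂ n` links are opened, and adjacent nodes are at most
`2 log₂ n` links apart (`IsGossip.exists_common`).

Flooding. From the source, a node joins once it has heard of all its neighbours and has been
reached; it then sends once along each incident link. Everyone has joined within O(D log n + log² n)
rounds (`join_all`), and parents join strictly before their children.

Collecting. For each `k`, a node that joined in round `τ` reports to its parent in round `3 * 2 ^ k
- τ`, so children report before parents. Once `2 ^ k` exceeds the joining time, everything reaches
the source (`facts_source_eq`). Only logarithmically many `k` matter. The source needs no knowledge
of `n`: by connectivity, facts closed under neighbours are complete (`eq_range_of_closed`).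

Broadcast. Complete facts determine one BFS tree for everybody. They descend it with one message per
edge, and all nodes stop in a common round computed from the height (`output_eq_none`, `config_eq`).
Summing the four kinds of messages gives `messageCount_le`. -/

namespace GossipBFS

/-! ### Abstract gossip: link trees, their doubling, and the spanner property -/

section Gossip

variable {V : Type*} (L : ℕ → V → V → Prop)

/-- Stay, or follow the link with label `j`. -/
def Hop (j : ℕ) (v w : V) : Prop := v = w ∨ L j v w

/-- `Tree L k v w`: `w` is reached from `v` along links with labels below `k`, in decreasing
order. -/
def Tree : ℕ → V → V → Prop
  | 0 => fun v w => v = w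
  | k + 1 => fun v w => ∃ x, Hop L k v x ∧ Tree k x w

/-- Who is heard of after `r` exchange steps of phase `i`: the labels `i, …, 0` are used forwards,
and then the labels `0, …, i` backwards. -/
def Reach (i : ℕ) : ℕ → V → V → Prop
  | 0 => fun u v => u = v
  | r + 1 => fun u v => ∃ x, Reach i r u x ∧
      ((r ≤ i ∧ Hop L (i - r) x v) ∨ (i < r ∧ Hop L (r - (i + 1)) v x))

variable {L}

theorem Tree.refl (k : ℕ) (v : V) : Tree L k v v := by
  induction k with
  | zero => rfl
  | succ k ih => exact ⟨v, Or.inl rfl, ih⟩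

theorem Reach.succ_iff (i r : ℕ) (u v : V) : Reach L i (r + 1) u v ↔ ∃ x, Reach L i r u x ∧
    ((r ≤ i ∧ Hop L (i - r) x v) ∨ (i < r ∧ Hop L (r - (i + 1)) v x)) := Iff.rfl

/-- In the forward half, removing the first hop of phase `i + 1` leaves phase `i` started at the far
end of that hop. This turns a recursion on the last step into the recursion of `Tree` on the first.
-/
theorem Reach.succ_down {i r : ℕ} (hr : r ≤ i + 1) (u v : V) :
    Reach L (i + 1) (r + 1) u v ↔ ∃ x, Hop L (i + 1) u x ∧ Reach L i r x v := by
  induction r generalizing v with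
  | zero =>
    constructor
    · rintro ⟨x, rfl, h | h⟩
      · exact ⟨v, h.2, rfl⟩
      · exact absurd h.1 (Nat.not_lt_zero _)
    · rintro ⟨x, h, rfl⟩
      exact ⟨u, rfl, Or.inl ⟨by omega, h⟩⟩
  | succ r ih =>
    have e : i + 1 - (r + 1) = i - r := by omega
    constructor
    · rintro ⟨y, h1, h2⟩
      obtain ⟨x, hx, hxy⟩ := (ih (by omega) y).1 h1
      refine ⟨x, hx, y, hxy, Or.inl ⟨by omega, ?_⟩⟩
      rcases h2 with h2 | h2
      · rw [← e]; exact h2.2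
      · exact absurd h2.1 (by omega)
    · rintro ⟨x, hx, y, hxy, h2⟩
      refine ⟨y, (ih (by omega) y).2 ⟨x, hx, hxy⟩, Or.inl ⟨by omega, ?_⟩⟩
      rcases h2 with h2 | h2
      · rw [e]; exact h2.2
      · exact absurd h2.1 (by omega)

theorem Reach.down (i : ℕ) (u v : V) : Reach L i (i + 1) u v ↔ Tree L (i + 1) u v := by
  induction i generalizing u with
  | zero =>
    constructor
    · rintro ⟨x, rfl, h | h⟩
      · exact ⟨v, h.2, rfl⟩
      · exact absurd h.1 (Nat.not_lt_zero _)
    · rintro ⟨x, h, rfl⟩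
      exact ⟨u, rfl, Or.inl ⟨le_refl _, h⟩⟩
  | succ i ih =>
    rw [Reach.succ_down le_rfl]
    exact exists_congr fun x => and_congr Iff.rfl (ih x)

/-- After the forward half an ID sits exactly on the tree of its owner. Each backward step lets `v`
read from the end of one of its own links, which prepends a hop to the tree of `v`. The case `r = i
+ 1` is the rule `IsGossip.succ`. -/
theorem Reach.up (i r : ℕ) (u v : V) :
    Reach L i (i + 1 + r) u v ↔ ∃ w, Tree L (i + 1) u w ∧ Tree L r v w := by
  induction r generalizing v with
  | zero =>
    rw [add_zero, Reach.down]
    exact ⟨fun h => ⟨v, h, rfl⟩, by rintro ⟨w, h, rfl⟩; exact h⟩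
  | succ r ih =>
    have e : i + 1 + r - (i + 1) = r := by omega
    rw [← add_assoc, Reach.succ_iff]
    constructor
    · rintro ⟨x, h1, h2⟩
      obtain ⟨w, h3, h4⟩ := (ih x).1 h1
      rcases h2 with h2 | h2
      · exact absurd h2.1 (by omega)
      · rw [e] at h2
        exact ⟨w, h3, x, h2.2, h4⟩
    · rintro ⟨w, h3, x, h5, h4⟩
      refine ⟨x, (ih x).2 ⟨w, h3, h4⟩, Or.inr ⟨by omega, ?_⟩⟩
      rw [e]; exact h5

variable (L)

/-- Some link with label `i` starts at `v`. -/
def Active (i : ℕ) (v : V) : Prop := ∃ w, L i v w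

/-- The rules of the gossip algorithm on the graph `G`: `L i v w` says that `v` opens a link to
`w` in phase `i`, and `R i v u` that `v` has heard of `u` before phase `i`. -/
structure IsGossip (G : SimpleGraph V) (R : ℕ → V → V → Prop) : Prop where
  zero : ∀ v u, ¬ R 0 v u
  succ : ∀ i v u, R (i + 1) v u ↔
    R i v u ∨ Active L i u ∧ ∃ w, Tree L (i + 1) u w ∧ Tree L (i + 1) v w
  fresh : ∀ i v w, L i v w → G.Adj v w ∧ ¬ R i v w
  active : ∀ i v w, G.Adj v w → ¬ R i v w → Active L i v
  unique : ∀ i v w w', L i v w → L i v w' → w = w'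

variable {L}

namespace IsGossip

variable {G : SimpleGraph V} {R : ℕ → V → V → Prop} (h : IsGossip L G R)
include h

theorem mono {i j : ℕ} (hij : i ≤ j) {v u : V} (hR : R i v u) : R j v u := by
  induction j, hij using Nat.le_induction with
  | base => exact hR
  | succ j _ ih => exact (h.succ j v u).2 (Or.inl ih)

theorem active_of_le {i j : ℕ} (hij : i ≤ j) {v : V} (ha : Active L j v) : Active L i v := by
  obtain ⟨w, hw⟩ := ha
  obtain ⟨h1, h2⟩ := h.fresh _ _ _ hw
  exact h.active i v w h1 fun h3 => h2 (h.mono hij h3)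

/-- Meeting of trees is symmetric; the only asymmetry in the rule is that the node heard of must be
active, which `ha` supplies. -/
theorem symm {i : ℕ} {v w : V} (hR : R i w v) (ha : ∀ m < i, Active L m w) : R i v w := by
  induction i with
  | zero => exact absurd hR (h.zero _ _)
  | succ i ih =>
    rcases (h.succ i w v).1 hR with h1 | ⟨_, x, hx, hx'⟩
    · exact (h.succ i v w).2 (Or.inl (ih h1 fun m hm => ha m (by omega)))
    · exact (h.succ i v w).2 (Or.inr ⟨ha i (by omega), x, hx', hx⟩)

/-- By induction `w` was active in all earlier phases, since `v` did not know it then either. So if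
`w` knew `v`, `symm` would make `v` know `w`; hence `w` misses `v` and is still active. -/
theorem active_of_not_known {i : ℕ} {v w : V} (hadj : G.Adj v w) (hR : ¬ R i v w) :
    Active L i w := by
  induction i using Nat.strong_induction_on with
  | _ i ih =>
    refine h.active i w v hadj.symm fun h1 => hR (h.symm h1 fun m hm => ih m hm ?_)
    exact fun h2 => hR (h.mono hm.le h2)

theorem active_of_link {i : ℕ} {v w : V} (hl : L i v w) : Active L i w :=
  h.active_of_not_known (h.fresh _ _ _ hl).1 (h.fresh _ _ _ hl).2

/-- A tree of level `i + 1` contains the level-`i` trees of `v` and of its new partner `x`. If these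
met, `v` would already have heard of the active node `x` and could not have linked to it. -/
theorem two_pow_le_ncard [Finite V] (i : ℕ) (v : V) (ha : ∀ m < i, Active L m v) :
    2 ^ i ≤ {w | Tree L i v w}.ncard := by
  induction i generalizing v with
  | zero =>
    rw [pow_zero, Nat.one_le_iff_ne_zero, Ne, Set.ncard_eq_zero (Set.toFinite _)]
    exact Set.Nonempty.ne_empty ⟨v, Tree.refl (L := L) 0 v⟩
  | succ i ih =>
    obtain ⟨x, hx⟩ := ha i (by omega)
    obtain ⟨hadj, hR⟩ := h.fresh _ _ _ hx
    have hax : Active L i x := h.active_of_link hx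
    have h1 := ih v fun m hm => ha m (by omega)
    have h2 := ih x fun m hm => h.active_of_le hm.le hax
    have hd : Disjoint {w | Tree L i v w} {w | Tree L i x w} := by
      rw [Set.disjoint_left]
      intro w hv hw
      -- Before phase 0 there was no exchange to contradict, but the trees of level 0 are single,
      -- distinct nodes.
      rcases i with _ | i
      · have e1 : v = w := hv
        have e2 : x = w := hw
        exact hadj.ne (e1.trans e2.symm)
      · exact hR ((h.succ i v x).2 (Or.inr ⟨h.active_of_le (by omega) hax, w, hw, hv⟩))
    calc 2 ^ (i + 1) = 2 ^ i + 2 ^ i := by ring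
      _ ≤ _ := Nat.add_le_add h1 h2
      _ = ({w | Tree L i v w} ∪ {w | Tree L i x w}).ncard := (Set.ncard_union_eq hd).symm
      _ ≤ _ := Set.ncard_le_ncard (by
        rintro w (hw | hw)
        · exact ⟨v, Or.inl rfl, hw⟩
        · exact ⟨x, Or.inr hx, hw⟩) (Set.toFinite _)

theorem lt_log_of_active [Fintype V] {i : ℕ} {v : V} (ha : Active L i v) :
    i < Nat.log 2 (Fintype.card V) := by
  have h1 := h.two_pow_le_ncard (i + 1) v fun m hm => h.active_of_le (by omega) ha
  have h2 : {w | Tree L (i + 1) v w}.ncard ≤ Fintype.card V := by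
    rw [← Nat.card_eq_fintype_card]; exact Set.ncard_le_card _
  exact Nat.le_log_of_pow_le (by norm_num) (h1.trans h2)

/-- Two descents to a common node give a path of at most `2 * i` links, which is the stretch of the
spanner. -/
theorem exists_common {i : ℕ} {v u : V} (hR : R i v u) :
    ∃ k ≤ i, ∃ w, Tree L k u w ∧ Tree L k v w := by
  induction i with
  | zero => exact absurd hR (h.zero _ _)
  | succ i ih =>
    rcases (h.succ i v u).1 hR with h1 | ⟨_, x, hx⟩
    · obtain ⟨k, hk, hw⟩ := ih h1
      exact ⟨k, by omega, hw⟩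
    · exact ⟨i + 1, le_rfl, x, hx⟩

end IsGossip

end Gossip

/-! ### Local choices and computations from collected facts -/

open Classical in
/-- Some element of `N` outside `R`, if there is one. -/
noncomputable def pick (N : Finset ℕ) (R : Set ℕ) : Option ℕ :=
  if h : ∃ x, x ∈ N ∧ x ∉ R then some h.choose else none

theorem pick_eq_some {N : Finset ℕ} {R : Set ℕ} {x : ℕ} (h : pick N R = some x) :
    x ∈ N ∧ x ∉ R := by
  unfold pick at h
  split_ifs at h with h1
  rw [← Option.some.inj h]
  exact h1.choose_spec

theorem pick_eq_none {N : Finset ℕ} {R : Set ℕ} : pick N R = none ↔ ↑N ⊆ R := by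
  unfold pick
  split_ifs with h1
  · obtain ⟨x, h2, h3⟩ := h1
    simp only [false_iff]
    exact fun h => h3 (h h2)
  · simp only [true_iff]
    intro x hx
    by_contra h2
    exact h1 ⟨x, hx, h2⟩

/-- What a node contributes to the global picture: its ID, the IDs of its neighbours, and whether
it is the source. -/
abbrev Fact := ℕ × Finset ℕ × Bool

/-- According to the facts `K`, there is a walk of length `k` from the source to `x`. -/
def WalkTo (K : Set Fact) : ℕ → ℕ → Prop
  | 0 => fun x => ∃ N, (x, N, true) ∈ K
  | k + 1 => fun x => ∃ y N b, (y, N, b) ∈ K ∧ x ∈ N ∧ WalkTo K k y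

/-- The distance from the source to `x` according to the facts `K`. -/
noncomputable def depth (K : Set Fact) (x : ℕ) : ℕ := sInf {k | WalkTo K k x}

open Classical in
/-- A neighbour of `x` that is closer to the source, if there is one. -/
noncomputable def treeParent (K : Set Fact) (x : ℕ) : Option ℕ :=
  if h : ∃ y, (∃ N b, (y, N, b) ∈ K ∧ x ∈ N) ∧ depth K x = depth K y + 1 then some h.choose
  else none

/-- The largest distance from the source according to the facts `K`. -/
noncomputable def height (K : Set Fact) : ℕ := sSup {k | ∃ f ∈ K, depth K f.1 = k}

/-- All neighbours that are mentioned in the facts `K` have contributed to `K`. -/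
def Closed (K : Set Fact) : Prop := ∀ x N b, (x, N, b) ∈ K → ∀ y ∈ N, ∃ f ∈ K, f.1 = y

/-! ### The schedule of phases -/

/-- Phase `i` has `2 * (i + 1)` rounds; `sched t` gives the phase of round `t`, and the position of
round `t` in its phase. -/
def sched : ℕ → ℕ × ℕ
  | 0 => (0, 0)
  | t + 1 => if (sched t).2 + 1 = 2 * ((sched t).1 + 1) then ((sched t).1 + 1, 0)
      else ((sched t).1, (sched t).2 + 1)

/-- The phase of round `t`. -/
def ph (t : ℕ) : ℕ := (sched t).1

/-- The position of round `t` in its phase. -/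
def ps (t : ℕ) : ℕ := (sched t).2

/-- The last round of a phase. -/
def IsLast (t : ℕ) : Prop := ps t + 1 = 2 * (ph t + 1)

/-- The first round of phase `i`. -/
def start (i : ℕ) : ℕ := i * (i + 1)

theorem ph_succ_of_last {t : ℕ} (h : IsLast t) : ph (t + 1) = ph t + 1 := by
  have h' : (sched t).2 + 1 = 2 * ((sched t).1 + 1) := h
  simp only [ph, sched, h', if_true]

theorem ps_succ_of_last {t : ℕ} (h : IsLast t) : ps (t + 1) = 0 := by
  have h' : (sched t).2 + 1 = 2 * ((sched t).1 + 1) := h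
  simp only [ps, sched, h', if_true]

theorem ph_succ_of_not_last {t : ℕ} (h : ¬ IsLast t) : ph (t + 1) = ph t := by
  have h' : ¬ (sched t).2 + 1 = 2 * ((sched t).1 + 1) := h
  simp only [ph, sched, h', if_false]

theorem ps_succ_of_not_last {t : ℕ} (h : ¬ IsLast t) : ps (t + 1) = ps t + 1 := by
  have h' : ¬ (sched t).2 + 1 = 2 * ((sched t).1 + 1) := h
  simp only [ps, sched, h', if_false]

theorem ps_lt (t : ℕ) : ps t < 2 * (ph t + 1) := by
  induction t with
  | zero => simp [ps, ph, sched]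
  | succ t ih =>
    by_cases h : IsLast t
    · rw [ps_succ_of_last h]; omega
    · rw [ps_succ_of_not_last h, ph_succ_of_not_last h]
      unfold IsLast at h
      omega

theorem start_succ (i : ℕ) : start (i + 1) = start i + 2 * (i + 1) := by
  unfold start; ring

theorem start_mono : StrictMono start :=
  strictMono_nat_of_lt_succ fun i => by rw [start_succ]; omega

theorem start_add_ps (t : ℕ) : start (ph t) + ps t = t := by
  induction t with
  | zero => simp [ps, ph, sched, start]
  | succ t ih =>
    by_cases h : IsLast t
    · rw [ps_succ_of_last h, ph_succ_of_last h, start_succ]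
      unfold IsLast at h
      omega
    · rw [ps_succ_of_not_last h, ph_succ_of_not_last h]
      omega

theorem start_ph_le (t : ℕ) : start (ph t) ≤ t := by
  have := start_add_ps t; omega

theorem lt_start_ph_succ (t : ℕ) : t < start (ph t + 1) := by
  have := start_add_ps t
  have := ps_lt t
  rw [start_succ]; omega

theorem le_ph_iff {i t : ℕ} : i ≤ ph t ↔ start i ≤ t := by
  constructor
  · intro h
    exact (start_mono.monotone h).trans (start_ph_le t)
  · intro h
    by_contra h1
    have h2 := start_mono.monotone (show ph t + 1 ≤ i by omega)
    have := lt_start_ph_succ t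
    omega

theorem ph_start (i : ℕ) : ph (start i) = i := by
  apply le_antisymm
  · exact start_mono.le_iff_le.1 (start_ph_le _)
  · exact le_ph_iff.2 le_rfl

theorem ps_start (i : ℕ) : ps (start i) = 0 := by
  have := start_add_ps (start i)
  rw [ph_start] at this
  omega

/-- The state of a node: the number of rounds so far, its initial knowledge, the links that it has
opened and those that were opened to it (with their labels), the IDs heard of in the current phase
and in the previous phases, the node from which it first learned of the source, the round in which
it joined the tree, the facts that it has collected, and the round in which the source knew the
whole graph. -/
structure State where
  time : ℕ
  own : ℕ
  nbrs : Finset ℕ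
  src : Bool
  link : ℕ → Option ℕ
  inl : Set (ℕ × ℕ)
  near : Set ℕ
  known : Set ℕ
  par : Option ℕ
  join : Option ℕ
  facts : Set Fact
  fin : Option ℕ

/-! ### The transition rules of a node -/

namespace State

open Classical in
/-- The state at the start. -/
noncomputable def initial (x : ℕ) (N : Finset ℕ) (b : Bool) : State where
  time := 0
  own := x
  nbrs := N
  src := b
  link := fun j => if j = 0 then pick N ∅ else none
  inl := ∅
  near := {y | y = x ∧ pick N ∅ ≠ none}
  known := ∅
  par := none
  join := none
  facts := {(x, N, b)}
  fin := none

/-- Whether a node sends its state to its neighbour `x`. -/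
def Wants (σ : State) (x : ℕ) : Prop :=
  -- The five reasons to send: gossip forwards, gossip backwards, flooding in the round of joining,
  -- reporting to the parent, and broadcast down the BFS tree. Gossip with nothing to report is
  -- suppressed, so it dies out without knowledge of `n`.
  (ps σ.time ≤ ph σ.time ∧ σ.link (ph σ.time - ps σ.time) = some x ∧ σ.near.Nonempty) ∨
  (ph σ.time < ps σ.time ∧ (ps σ.time - (ph σ.time + 1), x) ∈ σ.inl ∧ σ.near.Nonempty) ∨
  (σ.join = some σ.time ∧ ∃ j, j ≤ ph σ.time ∧ (σ.link j = some x ∨ (j, x) ∈ σ.inl)) ∨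
  (σ.par = some x ∧ ∃ τ k, σ.join = some τ ∧ σ.time + τ = 3 * 2 ^ k) ∨
  (∃ τ, σ.fin = some τ ∧ σ.time = τ + depth σ.facts σ.own ∧
    treeParent σ.facts x = some σ.own)

variable (σ : State) (I : Set (ℕ × State))

/-- The IDs heard of in this phase, after a round in which `I` is received. -/
def newNear : Set ℕ :=
  σ.near ∪ {x | ∃ p ∈ I, x ∈ p.2.near ∧
    ((ps σ.time ≤ ph σ.time ∧ p.2.link (ph σ.time - ps σ.time) = some σ.own) ∨
      (ph σ.time < ps σ.time ∧ σ.link (ps σ.time - (ph σ.time + 1)) = some p.1))}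

open Classical in
/-- The IDs heard of in finished phases, after a round in which `I` is received. -/
noncomputable def newKnown : Set ℕ :=
  if IsLast σ.time then σ.known ∪ σ.newNear I else σ.known

open Classical in
/-- The node from which a node first learned of the source, after a round in which `I` is
received. -/
noncomputable def newPar : Option ℕ :=
  if σ.par = none ∧ σ.src = false then
    if h : ∃ p ∈ I, p.2.join ≠ none then some h.choose.1 else none
  else σ.par

open Classical in
/-- The round in which a node joined the tree, after a round in which `I` is received. -/
noncomputable def newJoin : Option ℕ :=
  if σ.join = none then
    if ↑σ.nbrs ⊆ σ.newKnown I ∧ (σ.src = true ∨ σ.newPar I ≠ none) then some (σ.time + 1)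
    else none
  else σ.join

/-- The facts collected, after a round in which `I` is received. -/
def newFacts : Set Fact :=
  {f | f ∈ σ.facts ∨ ∃ p ∈ I, f ∈ p.2.facts}

open Classical in
/-- The round in which the source knew the whole graph, after a round in which `I` is received. -/
noncomputable def newFin : Option ℕ :=
  if σ.fin = none then
    if σ.src = true ∧ Closed (σ.newFacts I) then some (σ.time + 1)
    else if h : ∃ p ∈ I, p.2.fin ≠ none then h.choose.2.fin
    else none
  else σ.fin

open Classical in
/-- The state after a round in which `I` is received. -/
noncomputable def next : State where
  time := σ.time + 1
  own := σ.own
  nbrs := σ.nbrs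
  src := σ.src
  link := if IsLast σ.time then
      Function.update σ.link (ph σ.time + 1) (pick σ.nbrs (σ.newKnown I))
    else σ.link
  inl := σ.inl ∪ {q | ps σ.time ≤ ph σ.time ∧ ∃ p ∈ I,
    p.2.link (ph σ.time - ps σ.time) = some σ.own ∧ q = (ph σ.time - ps σ.time, p.1)}
  near := if IsLast σ.time then {y | y = σ.own ∧ pick σ.nbrs (σ.newKnown I) ≠ none}
    else σ.newNear I
  known := σ.newKnown I
  par := σ.newPar I
  join := σ.newJoin I
  facts := σ.newFacts I
  fin := σ.newFin I

end State

open Classical in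
/-- The breadth-first search algorithm. A node without neighbours terminates immediately; all other
nodes terminate in the same round, which is late enough for all of them to know the whole graph. -/
noncomputable def algorithm : KT1.LocalAlgorithm KT1.TreeOutput where
  State := State
  Msg := State
  init := State.initial
  send := fun σ x => if σ.Wants x then some σ else none
  step := State.next
  output := fun σ =>
    if σ.nbrs = ∅ then some ⟨none, ∅⟩
    else match σ.fin with
      | none => none
      | some τ => if τ + height σ.facts ≤ σ.time then
          some ⟨treeParent σ.facts σ.own,
            σ.nbrs.filter fun c => treeParent σ.facts c = some σ.own⟩
        else none

/-! ### The run realises abstract gossip -/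

section Run

variable {V : Type*} [Fintype V] [DecidableEq V] (G : SimpleGraph V) [DecidableRel G.Adj]
  (id : V → ℕ) (s : V)

/-- The messages received by `v` if nobody has terminated. -/
def received (c : V → State) (v : V) : Set (ℕ × State) :=
  {p | ∃ w, G.Adj w v ∧ p = (id w, c w) ∧ (c w).Wants (id v)}

/-- The states of the nodes after `t` rounds if nobody terminates. -/
noncomputable def run : ℕ → V → State
  | 0 => fun v => State.initial (id v) ((G.neighborFinset v).image id) (decide (v = s))
  | t + 1 => fun v => (run t v).next (received G id (run t) v)

/-- In phase `j`, the node `v` opens a link to `w`. -/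
def Link (j : ℕ) (v w : V) : Prop := (run G id s (start j) v).link j = some (id w)

/-- Before phase `i`, the node `v` has heard of `u`. -/
def Knows (i : ℕ) (v u : V) : Prop := id u ∈ (run G id s (start i) v).known

theorem run_succ (t : ℕ) (v : V) :
    run G id s (t + 1) v = (run G id s t v).next (received G id (run G id s t) v) := rfl

@[simp] theorem run_time (t : ℕ) (v : V) : (run G id s t v).time = t := by
  induction t with
  | zero => rfl
  | succ t ih => exact congrArg (· + 1) ih

@[simp] theorem run_own (t : ℕ) (v : V) : (run G id s t v).own = id v := by
  induction t with
  | zero => rfl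
  | succ t ih => exact ih

@[simp] theorem run_nbrs (t : ℕ) (v : V) :
    (run G id s t v).nbrs = (G.neighborFinset v).image id := by
  induction t with
  | zero => rfl
  | succ t ih => exact ih

@[simp] theorem run_src (t : ℕ) (v : V) : (run G id s t v).src = decide (v = s) := by
  induction t with
  | zero => rfl
  | succ t ih => exact ih

omit [DecidableEq V] in
theorem mem_nbrs {x : ℕ} {v : V} :
    x ∈ (G.neighborFinset v).image id ↔ ∃ w, G.Adj v w ∧ id w = x := by
  simp

theorem run_known_succ (t : ℕ) (v : V) : (run G id s (t + 1) v).known =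
    (run G id s t v).newKnown (received G id (run G id s t) v) := rfl

theorem run_link_of_last {t : ℕ} (h : IsLast t) (v : V) : (run G id s (t + 1) v).link =
    Function.update (run G id s t v).link (ph t + 1)
      (pick ((G.neighborFinset v).image id) (run G id s (t + 1) v).known) := by
  rw [run_known_succ, run_succ]
  simp [State.next, h]

theorem run_link_of_not_last {t : ℕ} (h : ¬ IsLast t) (v : V) :
    (run G id s (t + 1) v).link = (run G id s t v).link := by
  rw [run_succ]
  simp [State.next, h]

theorem run_known_of_last {t : ℕ} (h : IsLast t) (v : V) : (run G id s (t + 1) v).known =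
    (run G id s t v).known ∪ (run G id s t v).newNear (received G id (run G id s t) v) := by
  rw [run_known_succ]
  simp [State.newKnown, h]

theorem run_known_of_not_last {t : ℕ} (h : ¬ IsLast t) (v : V) :
    (run G id s (t + 1) v).known = (run G id s t v).known := by
  rw [run_known_succ]
  simp [State.newKnown, h]

theorem run_near_of_last {t : ℕ} (h : IsLast t) (v : V) : (run G id s (t + 1) v).near =
    {y | y = id v ∧ pick ((G.neighborFinset v).image id) (run G id s (t + 1) v).known ≠ none} := by
  rw [run_known_succ, run_succ]
  simp [State.next, h]

theorem run_near_of_not_last {t : ℕ} (h : ¬ IsLast t) (v : V) : (run G id s (t + 1) v).near =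
    (run G id s t v).newNear (received G id (run G id s t) v) := by
  rw [run_succ]
  simp [State.next, h]

theorem mem_run_inl_succ {t : ℕ} {v : V} {q : ℕ × ℕ} : q ∈ (run G id s (t + 1) v).inl ↔
    q ∈ (run G id s t v).inl ∨ ps t ≤ ph t ∧ ∃ w, G.Adj w v ∧ (run G id s t w).Wants (id v) ∧
      (run G id s t w).link (ph t - ps t) = some (id v) ∧ q = (ph t - ps t, id w) := by
  rw [run_succ]
  simp only [State.next, run_time, run_own, received, Set.mem_union, Set.mem_ofPred_eq]
  refine or_congr Iff.rfl (and_congr Iff.rfl ⟨?_, ?_⟩)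
  · rintro ⟨_, ⟨w, h1, rfl, h2⟩, h3⟩
    exact ⟨w, h1, h2, h3⟩
  · rintro ⟨w, h1, h2, h3⟩
    exact ⟨_, ⟨w, h1, rfl, h2⟩, h3⟩

theorem mem_newNear {t : ℕ} {v : V} {x : ℕ} :
    x ∈ (run G id s t v).newNear (received G id (run G id s t) v) ↔
    x ∈ (run G id s t v).near ∨ ∃ w, G.Adj w v ∧ (run G id s t w).Wants (id v) ∧
      x ∈ (run G id s t w).near ∧
      ((ps t ≤ ph t ∧ (run G id s t w).link (ph t - ps t) = some (id v)) ∨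
        (ph t < ps t ∧ (run G id s t v).link (ps t - (ph t + 1)) = some (id w))) := by
  simp only [State.newNear, run_time, run_own, received, Set.mem_union, Set.mem_ofPred_eq]
  refine or_congr Iff.rfl ⟨?_, ?_⟩
  · rintro ⟨_, ⟨w, h1, rfl, h2⟩, h3⟩
    exact ⟨w, h1, h2, h3⟩
  · rintro ⟨w, h1, h2, h3⟩
    exact ⟨_, ⟨w, h1, rfl, h2⟩, h3⟩

/-- The gossip part of the state of `v` after `t` rounds is as intended. -/
structure GossipInv (t : ℕ) (v : V) : Prop where
  link_eq : ∀ j ≤ ph t, (run G id s t v).link j = (run G id s (start j) v).link j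
  link_adj : ∀ j ≤ ph t, ∀ x, (run G id s t v).link j = some x → ∃ w, G.Adj v w ∧ id w = x
  known_eq : (run G id s t v).known = (run G id s (start (ph t)) v).known
  link_pick : (run G id s t v).link (ph t) =
    pick ((G.neighborFinset v).image id) (run G id s t v).known
  near_eq : (run G id s t v).near = {x | ∃ u, x = id u ∧ Active (Link G id s) (ph t) u ∧
    Reach (Link G id s) (ph t) (ps t) u v}
  inl_sound : ∀ j x, (j, x) ∈ (run G id s t v).inl →
    ∃ w, G.Adj w v ∧ x = id w ∧ Link G id s j w v
  inl_complete : ∀ j w, Link G id s j w v → start j < t → (j, id w) ∈ (run G id s t v).inl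

variable {G id s}

theorem GossipInv.link_iff {t : ℕ} {v : V} (h : GossipInv G id s t v) {j : ℕ} (hj : j ≤ ph t)
    (w : V) : (run G id s t v).link j = some (id w) ↔ Link G id s j v w := by
  unfold Link
  rw [h.link_eq j hj]

theorem GossipInv.adj (hid : id.Injective) {t : ℕ} {v : V} (h : GossipInv G id s t v) {j : ℕ}
    (hj : j ≤ ph t) {w : V} (hl : Link G id s j v w) : G.Adj v w := by
  obtain ⟨w', h1, h2⟩ := h.link_adj j hj _ ((h.link_iff hj w).2 hl)
  rwa [← hid h2]

/-- A gossip message is suppressed only if its sender has nothing to report, and messages sent for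
other reasons add IDs only along the scheduled links. So one round is exactly one step of `Reach`.
-/
theorem newNear_eq (hid : id.Injective) {t : ℕ} (h : ∀ v, GossipInv G id s t v) (v : V) :
    (run G id s t v).newNear (received G id (run G id s t) v) =
      {x | ∃ u, x = id u ∧ Active (Link G id s) (ph t) u ∧
        Reach (Link G id s) (ph t) (ps t + 1) u v} := by
  ext x
  rw [mem_newNear]
  have hlt := ps_lt t
  have hst := start_add_ps t
  constructor
  · rintro (hx | ⟨w, hadj, _, hx, hc⟩)
    · rw [(h v).near_eq] at hx
      obtain ⟨u, hu, ha, hr⟩ := hx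
      refine ⟨u, hu, ha, v, hr, ?_⟩
      rcases le_or_gt (ps t) (ph t) with hp | hp
      · exact Or.inl ⟨hp, Or.inl rfl⟩
      · exact Or.inr ⟨hp, Or.inl rfl⟩
    · rw [(h w).near_eq] at hx
      obtain ⟨u, hu, ha, hr⟩ := hx
      refine ⟨u, hu, ha, w, hr, ?_⟩
      rcases hc with ⟨hp, hl⟩ | ⟨hp, hl⟩
      · exact Or.inl ⟨hp, Or.inr (((h w).link_iff (by omega) v).1 hl)⟩
      · exact Or.inr ⟨hp, Or.inr (((h v).link_iff (by omega) w).1 hl)⟩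
  · rintro ⟨u, rfl, ha, w, hr, hc⟩
    have hw : id u ∈ (run G id s t w).near := by
      rw [(h w).near_eq]; exact ⟨u, rfl, ha, hr⟩
    rcases hc with ⟨hp, rfl | hl⟩ | ⟨hp, rfl | hl⟩
    · exact Or.inl hw
    · have hl' := ((h w).link_iff (by omega) v).2 hl
      refine Or.inr ⟨w, (h w).adj hid (by omega) hl, Or.inl ?_, hw, Or.inl ⟨hp, hl'⟩⟩
      simpa using ⟨hp, hl', ⟨_, hw⟩⟩
    · exact Or.inl hw
    · have hl' := ((h v).link_iff (by omega) w).2 hl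
      -- In the backward half at least one round of the phase is over, so the far end has registered
      -- every incoming link up to the current label.
      have hj : start (ps t - (ph t + 1)) ≤ start (ph t) := start_mono.monotone (by omega)
      refine Or.inr ⟨w, ((h v).adj hid (by omega) hl).symm, Or.inr (Or.inl ?_), hw,
        Or.inr ⟨hp, hl'⟩⟩
      simpa using ⟨hp, (h w).inl_complete _ v hl (by omega), ⟨_, hw⟩⟩

theorem inl_sound_succ {t : ℕ} (h : ∀ v, GossipInv G id s t v) {v : V} {j x : ℕ}
    (hx : (j, x) ∈ (run G id s (t + 1) v).inl) : ∃ w, G.Adj w v ∧ x = id w ∧ Link G id s j w v := by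
  rcases (mem_run_inl_succ ..).1 hx with h1 | ⟨hp, w, hadj, _, hl, e⟩
  · exact (h v).inl_sound j x h1
  · obtain ⟨rfl, rfl⟩ := Prod.mk.inj e
    exact ⟨w, hadj, rfl, ((h w).link_iff (by omega) v).1 hl⟩

/-- Label `j` is first used at position 0 of phase `j`. The opener is active and so holds its own
ID, hence its message is really sent and registers the link. -/
theorem inl_complete_succ (hid : id.Injective) {t : ℕ} (h : ∀ v, GossipInv G id s t v) {v : V}
    {j : ℕ} {w : V} (hl : Link G id s j w v) (hj : start j < t + 1) :
    (j, id w) ∈ (run G id s (t + 1) v).inl := by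
  rw [mem_run_inl_succ]
  rcases Nat.lt_succ_iff_lt_or_eq.1 hj with h1 | h1
  · exact Or.inl ((h v).inl_complete j w hl h1)
  · right
    have e1 : ph t = j := by rw [← h1, ph_start]
    have e2 : ps t = 0 := by rw [← h1, ps_start]
    have hl' := ((h w).link_iff e1.ge v).2 hl
    have hn : (run G id s t w).near.Nonempty := by
      refine ⟨id w, ?_⟩
      rw [(h w).near_eq]
      refine ⟨w, rfl, ⟨v, by rwa [e1]⟩, ?_⟩
      rw [e2]; rfl
    refine ⟨by omega, w, (h w).adj hid e1.ge hl, Or.inl ?_, ?_, ?_⟩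
    · simpa [e1, e2] using ⟨hl', hn⟩
    · simpa [e1, e2] using hl'
    · simp [e1, e2]

theorem active_iff_link_ne_none {j : ℕ} {v : V}
    (h : ∀ x, (run G id s (start j) v).link j = some x → ∃ w, G.Adj v w ∧ id w = x) :
    Active (Link G id s) j v ↔ (run G id s (start j) v).link j ≠ none := by
  constructor
  · rintro ⟨w, hw⟩ h1
    rw [Link, h1] at hw
    exact absurd hw (by simp)
  · intro h1
    obtain ⟨x, hx⟩ := Option.ne_none_iff_exists'.1 h1
    obtain ⟨w, _, rfl⟩ := h x hx
    exact ⟨w, hx⟩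

theorem gossipInv (hid : id.Injective) (t : ℕ) (v : V) : GossipInv G id s t v := by
  induction t generalizing v with
  | zero =>
    have e1 : ph 0 = 0 := rfl
    have e2 : start 0 = 0 := rfl
    have hadj : ∀ x, (run G id s 0 v).link 0 = some x → ∃ w, G.Adj v w ∧ id w = x := by
      intro x hx
      exact (mem_nbrs G id).1 (pick_eq_some (N := (G.neighborFinset v).image id) (R := ∅)
        (by simpa [run, State.initial] using hx)).1
    refine ⟨?_, ?_, ?_, ?_, ?_, ?_, ?_⟩
    · intro j hj
      obtain rfl : j = 0 := by omega
      rfl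
    · intro j hj
      obtain rfl : j = 0 := by omega
      exact hadj
    · rw [e1, e2]
    · simp [run, State.initial, e1]
    · ext x
      have := active_iff_link_ne_none (G := G) (id := id) (s := s) (j := 0) (v := v) hadj
      constructor
      · rintro ⟨rfl, h2⟩
        refine ⟨v, rfl, this.2 ?_, rfl⟩
        simpa [run, State.initial, e2] using h2
      · rintro ⟨u, rfl, h2, h3⟩
        obtain rfl : u = v := h3
        refine ⟨rfl, ?_⟩
        simpa [run, State.initial, e2] using this.1 h2
    · intro j x hx
      exact absurd hx (Set.notMem_empty _)
    · intro j w _ h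
      omega
  | succ t ih =>
    have hs := fun j x => inl_sound_succ (j := j) (x := x) ih (v := v)
    have hc := fun j w => inl_complete_succ (j := j) (w := w) hid ih (v := v)
    by_cases hlast : IsLast t
    · have e1 := ph_succ_of_last hlast
      have e2 := ps_succ_of_last hlast
      have e3 : start (ph t + 1) = t + 1 := by
        have := start_add_ps (t + 1)
        rw [e1, e2] at this
        omega
      have hpick : (run G id s (t + 1) v).link (ph t + 1) =
          pick ((G.neighborFinset v).image id) (run G id s (t + 1) v).known := by
        rw [run_link_of_last G id s hlast, Function.update_self]
      have hold : ∀ j ≤ ph t, (run G id s (t + 1) v).link j = (run G id s t v).link j := by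
        intro j hj
        rw [run_link_of_last G id s hlast, Function.update_of_ne (by omega)]
      have hadj : ∀ x, (run G id s (t + 1) v).link (ph t + 1) = some x →
          ∃ w, G.Adj v w ∧ id w = x := by
        intro x hx
        rw [hpick] at hx
        exact (mem_nbrs G id).1 (pick_eq_some hx).1
      refine ⟨?_, ?_, ?_, ?_, ?_, hs, hc⟩
      · intro j hj
        rcases Nat.lt_or_ge (ph t) j with h1 | h1
        · obtain rfl : j = ph t + 1 := by omega
          rw [e3]
        · rw [hold j h1]; exact (ih v).link_eq j h1
      · intro j hj x hx
        rcases Nat.lt_or_ge (ph t) j with h1 | h1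
        · obtain rfl : j = ph t + 1 := by omega
          exact hadj x hx
        · rw [hold j h1] at hx; exact (ih v).link_adj j h1 x hx
      · rw [e1, e3]
      · rw [e1, hpick]
      · have := active_iff_link_ne_none (G := G) (id := id) (s := s) (j := ph t + 1) (v := v)
          (by rw [e3]; exact hadj)
        rw [e3, hpick] at this
        rw [run_near_of_last G id s hlast, e1, e2]
        ext x
        constructor
        · rintro ⟨rfl, h2⟩
          exact ⟨v, rfl, this.2 h2, rfl⟩
        · rintro ⟨u, rfl, h2, h3⟩
          obtain rfl : u = v := h3
          exact ⟨rfl, this.1 h2⟩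
    · have e1 := ph_succ_of_not_last hlast
      have e2 := ps_succ_of_not_last hlast
      have e3 := run_link_of_not_last G id s hlast v
      have e4 := run_known_of_not_last G id s hlast v
      refine ⟨?_, ?_, ?_, ?_, ?_, hs, hc⟩
      · rw [e1, e3]; exact (ih v).link_eq
      · rw [e1, e3]; exact (ih v).link_adj
      · rw [e1, e4]; exact (ih v).known_eq
      · rw [e1, e3, e4]; exact (ih v).link_pick
      · rw [run_near_of_not_last G id s hlast, e1, e2]
        exact newNear_eq hid ih v

theorem link_start_eq_pick (hid : id.Injective) (i : ℕ) (v : V) :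
    (run G id s (start i) v).link i =
      pick ((G.neighborFinset v).image id) (run G id s (start i) v).known := by
  have := (gossipInv (G := G) (s := s) hid (start i) v).link_pick
  rwa [ph_start] at this

theorem active_iff_not_subset (hid : id.Injective) (i : ℕ) (v : V) :
    Active (Link G id s) i v ↔
      ¬ ↑((G.neighborFinset v).image id) ⊆ (run G id s (start i) v).known := by
  rw [active_iff_link_ne_none ((gossipInv hid _ v).link_adj i (ph_start i).ge), link_start_eq_pick hid, Ne, pick_eq_none]

theorem isGossip (hid : id.Injective) : IsGossip (Link G id s) G (Knows G id s) where
  zero := fun v u h => h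
  succ := by
    intro i v u
    obtain ⟨t, ht⟩ : ∃ t, start (i + 1) = t + 1 := ⟨start i + 2 * i + 1, by
      rw [start_succ]; omega⟩
    have hlast : IsLast t ∧ ph t = i := by
      have h1 : ph (t + 1) = i + 1 := by rw [← ht, ph_start]
      have h2 : ps (t + 1) = 0 := by rw [← ht, ps_start]
      by_cases h : IsLast t
      · rw [ph_succ_of_last h] at h1
        exact ⟨h, by omega⟩
      · rw [ps_succ_of_not_last h] at h2
        omega
    have hps : ps t + 1 = i + 1 + (i + 1) := by
      have h1 : ps t + 1 = 2 * (ph t + 1) := hlast.1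
      omega
    have hI := gossipInv (G := G) (s := s) hid t
    unfold Knows
    rw [ht, run_known_of_last G id s hlast.1, newNear_eq hid hI, (hI v).known_eq, hlast.2, hps,
      Set.mem_union]
    refine or_congr Iff.rfl ⟨?_, ?_⟩
    · rintro ⟨u', hu, ha, hr⟩
      obtain rfl := hid hu
      exact ⟨ha, (Reach.up _ _ _ _).1 hr⟩
    · rintro ⟨ha, hr⟩
      exact ⟨u, rfl, ha, (Reach.up _ _ _ _).2 hr⟩
  fresh := by
    intro i v w hl
    have h1 := hl
    unfold Link at h1
    rw [link_start_eq_pick hid] at h1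
    exact ⟨(gossipInv hid (start i) v).adj hid (ph_start i).ge hl, (pick_eq_some h1).2⟩
  active := by
    intro i v w hadj hk
    rw [active_iff_not_subset hid]
    exact fun h => hk (h ((mem_nbrs G id).2 ⟨w, hadj, rfl⟩))
  unique := by
    intro i v w w' h1 h2
    unfold Link at h1 h2
    exact hid (Option.some.inj (h1.symm.trans h2))

end Run

/-! ### Joining, collecting facts at the source, and detecting completeness -/

section Flood

variable {V : Type*} [Fintype V] [DecidableEq V] {G : SimpleGraph V} [DecidableRel G.Adj]
  {id : V → ℕ} {s : V}

variable (G id s) in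
/-- What `v` contributes to the global picture. -/
def fact (v : V) : Fact := (id v, (G.neighborFinset v).image id, decide (v = s))

/-- The node `v` has heard of all its neighbours. -/
def Done (G : SimpleGraph V) [DecidableRel G.Adj] (id : V → ℕ) (s : V) (t : ℕ) (v : V) : Prop :=
  ↑((G.neighborFinset v).image id) ⊆ (run G id s t v).known

theorem done_iff (hid : id.Injective) (t : ℕ) (v : V) :
    Done G id s t v ↔ ¬ Active (Link G id s) (ph t) v := by
  rw [active_iff_not_subset hid, not_not, ← (gossipInv hid t v).known_eq, Done]

/-- Activity never resumes. As both ends of a link are active, a node that is done will see no new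
incident link in either direction. -/
theorem lt_ph_of_done (hid : id.Injective) {t j : ℕ} {v : V} (hd : Done G id s t v)
    (ha : Active (Link G id s) j v) : j < ph t := by
  by_contra h
  exact (done_iff hid t v).1 hd ((isGossip hid).active_of_le (not_lt.1 h) ha)

theorem done_of_start_log_le (hid : id.Injective) {t : ℕ}
    (ht : start (Nat.log 2 (Fintype.card V)) ≤ t) (v : V) : Done G id s t v := by
  rw [done_iff hid]
  intro ha
  have := (isGossip hid).lt_log_of_active ha
  have := le_ph_iff.2 ht
  omega

theorem run_par_of_ne {t : ℕ} {v : V} (h : (run G id s t v).par ≠ none) :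
    (run G id s (t + 1) v).par = (run G id s t v).par := by
  rw [run_succ]
  simp [State.next, State.newPar, h]

theorem run_par_of_join {t : ℕ} {v w : V} (hs : w ≠ s) (hadj : G.Adj v w)
    (hw : (run G id s t v).Wants (id w)) (hj : (run G id s t v).join ≠ none) :
    (run G id s (t + 1) w).par ≠ none := by
  by_cases h : (run G id s t w).par = none
  · have h1 : ∃ p ∈ received G id (run G id s t) w, p.2.join ≠ none :=
      ⟨_, ⟨v, hadj, rfl, hw⟩, hj⟩
    rw [run_succ]
    simp only [State.next, State.newPar, h, run_src, hs, decide_false, and_self, if_true]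
    rw [dif_pos h1]
    simp
  · rwa [run_par_of_ne h]

theorem exists_of_run_par {t : ℕ} {v : V} {x : ℕ} (h : (run G id s (t + 1) v).par = some x) :
    (run G id s t v).par = some x ∨
      ∃ p, G.Adj p v ∧ x = id p ∧ (run G id s t p).join ≠ none := by
  by_cases h1 : (run G id s t v).par = none ∧ v ≠ s
  · right
    rw [run_succ] at h
    simp only [State.next, State.newPar, run_src, decide_eq_false_iff_not] at h
    rw [if_pos h1] at h
    split_ifs at h with h2
    obtain ⟨⟨p, hadj, he, _⟩, h3⟩ := h2.choose_spec
    refine ⟨p, hadj, ?_, ?_⟩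
    · rw [← Option.some.inj h, he]
    · rwa [he] at h3
  · left
    rw [run_succ] at h
    simp only [State.next, State.newPar, run_src, decide_eq_false_iff_not] at h
    rwa [if_neg h1] at h

theorem run_join_of_ne {t : ℕ} {v : V} (h : (run G id s t v).join ≠ none) :
    (run G id s (t + 1) v).join = (run G id s t v).join := by
  rw [run_succ]
  simp [State.next, State.newJoin, h]

open Classical in
theorem run_join_of_eq {t : ℕ} {v : V} (h : (run G id s t v).join = none) :
    (run G id s (t + 1) v).join =
      if Done G id s (t + 1) v ∧ (v = s ∨ (run G id s (t + 1) v).par ≠ none) then some (t + 1)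
      else none := by
  rw [run_succ]
  unfold Done
  rw [run_succ]
  simp only [State.next, State.newJoin, h, if_true, run_src, run_nbrs, run_time, decide_eq_true_eq]

theorem run_join_stable {t t' : ℕ} (h : t ≤ t') {v : V} {τ : ℕ}
    (hj : (run G id s t v).join = some τ) : (run G id s t' v).join = some τ := by
  induction t', h using Nat.le_induction with
  | base => exact hj
  | succ t' _ ih => rw [run_join_of_ne (by simp [ih]), ih]

theorem run_par_stable {t t' : ℕ} (h : t ≤ t') {v : V} {x : ℕ}
    (hj : (run G id s t v).par = some x) : (run G id s t' v).par = some x := by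
  induction t', h using Nat.le_induction with
  | base => exact hj
  | succ t' _ ih => rw [run_par_of_ne (by simp [ih]), ih]

theorem of_run_join {t : ℕ} {v : V} {τ : ℕ} (h : (run G id s t v).join = some τ) :
    τ ≤ t ∧ (run G id s τ v).join = some τ ∧ Done G id s τ v ∧
      (v = s ∨ (run G id s τ v).par ≠ none) := by
  induction t with
  | zero => exact absurd h (by simp [run, State.initial])
  | succ t ih =>
    by_cases h1 : (run G id s t v).join = none
    · have h2 := run_join_of_eq h1
      split_ifs at h2 with h3
      · have h4 : t + 1 = τ := Option.some.inj (h2.symm.trans h)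
        subst h4
        exact ⟨le_rfl, h, h3⟩
      · rw [h2] at h
        exact absurd h (by simp)
    · rw [run_join_of_ne h1] at h
      obtain ⟨h2, h3⟩ := ih h
      exact ⟨by omega, h3⟩

theorem of_run_par {t : ℕ} {v : V} {x : ℕ} (h : (run G id s t v).par = some x) :
    ∃ p τ, G.Adj p v ∧ x = id p ∧ (run G id s t p).join = some τ ∧ τ < t := by
  induction t with
  | zero => exact absurd h (by simp [run, State.initial])
  | succ t ih =>
    rcases exists_of_run_par h with h1 | ⟨p, h1, h2, h3⟩
    · obtain ⟨p, τ, h2, h3, h4, h5⟩ := ih h1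
      exact ⟨p, τ, h2, h3, run_join_stable (by omega) h4, by omega⟩
    · obtain ⟨τ, hτ⟩ := Option.ne_none_iff_exists'.1 h3
      have := (of_run_join hτ).1
      exact ⟨p, τ, h1, h2, run_join_stable (by omega) hτ, by omega⟩

/-- Join rounds strictly decrease towards the source; this orders the reports in the collecting
stage. -/
theorem par_of_run_join {t : ℕ} {v : V} {τ : ℕ} (h : (run G id s t v).join = some τ)
    (hv : v ≠ s) : ∃ p τ', G.Adj p v ∧ (run G id s t v).par = some (id p) ∧
      (run G id s t p).join = some τ' ∧ τ' < τ := by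
  obtain ⟨h1, _, _, h2⟩ := of_run_join h
  obtain ⟨x, hx⟩ := Option.ne_none_iff_exists'.1 (h2.resolve_left hv)
  obtain ⟨p, τ', h3, rfl, h4, h5⟩ := of_run_par hx
  exact ⟨p, τ', h3, run_par_stable h1 hx, run_join_stable h1 h4, h5⟩

/-- Joining waits until the node is done, so all its links are open and registered by then, and the
single sending in the join round serves each of them. -/
theorem par_of_link (hid : id.Injective) {t j : ℕ} {v w : V}
    (hl : Link G id s j v w ∨ Link G id s j w v) (hj : (run G id s t v).join ≠ none) :
    w = s ∨ (run G id s (t + 1) w).par ≠ none := by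
  rw [or_iff_not_imp_left]
  intro hw
  obtain ⟨τ, hτ⟩ := Option.ne_none_iff_exists'.1 hj
  obtain ⟨h1, h2, h3, _⟩ := of_run_join hτ
  have hg := isGossip (G := G) (s := s) hid
  have ha : Active (Link G id s) j v := by
    rcases hl with hl | hl
    · exact ⟨w, hl⟩
    · exact hg.active_of_link hl
  have hlt := lt_ph_of_done hid h3 ha
  have hadj : G.Adj v w := by
    rcases hl with hl | hl
    · exact (hg.fresh _ _ _ hl).1
    · exact (hg.fresh _ _ _ hl).1.symm
  have hst : start j < τ := (start_mono hlt).trans_le (start_ph_le τ)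
  have hI := gossipInv (G := G) (s := s) hid τ v
  have hwants : (run G id s τ v).Wants (id w) := by
    refine Or.inr (Or.inr (Or.inl ⟨by rw [h2, run_time], j, by rw [run_time]; exact hlt.le, ?_⟩))
    rcases hl with hl | hl
    · exact Or.inl ((hI.link_iff hlt.le w).2 hl)
    · exact Or.inr (hI.inl_complete j w hl hst)
  obtain ⟨x, hx⟩ := Option.ne_none_iff_exists'.1
    (run_par_of_join hw hadj hwants (by rw [h2]; simp))
  rw [run_par_stable (by omega) hx]
  simp

theorem join_succ {t : ℕ} {v : V} (hd : Done G id s (t + 1) v)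
    (h : v = s ∨ (run G id s (t + 1) v).par ≠ none) : (run G id s (t + 1) v).join ≠ none := by
  by_cases h1 : (run G id s t v).join = none
  · rw [run_join_of_eq h1, if_pos ⟨hd, h⟩]
    simp
  · rwa [run_join_of_ne h1]

theorem join_mono {t t' : ℕ} (h : t ≤ t') {v : V} (hj : (run G id s t v).join ≠ none) :
    (run G id s t' v).join ≠ none := by
  obtain ⟨τ, hτ⟩ := Option.ne_none_iff_exists'.1 hj
  rw [run_join_stable h hτ]
  simp

theorem join_of_link (hid : id.Injective) {t j : ℕ} {v w : V}
    (ht : start (Nat.log 2 (Fintype.card V)) ≤ t)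
    (hl : Link G id s j v w ∨ Link G id s j w v) (hj : (run G id s t v).join ≠ none) :
    (run G id s (t + 1) w).join ≠ none :=
  join_succ (done_of_start_log_le hid (by omega) w) (par_of_link hid hl hj)

theorem join_of_hop (hid : id.Injective) {t j : ℕ} {v w : V}
    (ht : start (Nat.log 2 (Fintype.card V)) ≤ t)
    (hl : Hop (Link G id s) j v w ∨ Hop (Link G id s) j w v)
    (hj : (run G id s t v).join ≠ none) : (run G id s (t + 1) w).join ≠ none := by
  rcases hl with (rfl | hl) | (rfl | hl)
  · exact join_mono (by omega) hj
  · exact join_of_link hid ht (Or.inl hl) hj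
  · exact join_mono (by omega) hj
  · exact join_of_link hid ht (Or.inr hl) hj

theorem join_of_tree (hid : id.Injective) {t k : ℕ} {v w : V}
    (ht : start (Nat.log 2 (Fintype.card V)) ≤ t) (hl : Tree (Link G id s) k v w)
    (hj : (run G id s t v).join ≠ none) : (run G id s (t + k) w).join ≠ none := by
  induction k generalizing t v with
  | zero => obtain rfl : v = w := hl; exact hj
  | succ k ih =>
    obtain ⟨x, h1, h2⟩ := hl
    have := ih (t := t + 1) (by omega) h2 (join_of_hop hid ht (Or.inl h1) hj)
    rwa [show t + (k + 1) = t + 1 + k by omega]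

theorem join_of_tree_symm (hid : id.Injective) {t k : ℕ} {v w : V}
    (ht : start (Nat.log 2 (Fintype.card V)) ≤ t) (hl : Tree (Link G id s) k w v)
    (hj : (run G id s t v).join ≠ none) : (run G id s (t + k) w).join ≠ none := by
  induction k generalizing w with
  | zero => obtain rfl : w = v := hl; exact hj
  | succ k ih =>
    obtain ⟨x, h1, h2⟩ := hl
    exact join_of_hop hid (ht.trans (Nat.le_add_right t k)) (Or.inr h1) (ih h2)

theorem join_of_adj (hid : id.Injective) {t : ℕ} {v w : V}
    (ht : start (Nat.log 2 (Fintype.card V)) ≤ t) (hadj : G.Adj v w)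
    (hj : (run G id s t v).join ≠ none) :
    (run G id s (t + 2 * Nat.log 2 (Fintype.card V)) w).join ≠ none := by
  have hg := isGossip (G := G) (s := s) hid
  have hk : Knows G id s (Nat.log 2 (Fintype.card V)) v w := by
    by_contra h
    exact lt_irrefl _ (hg.lt_log_of_active (hg.active _ v w hadj h))
  obtain ⟨k, hkl, x, hwx, hvx⟩ := hg.exists_common hk
  exact join_mono (by omega)
    (join_of_tree_symm hid (by omega) hwx (join_of_tree hid ht hvx hj))

theorem join_of_walk (hid : id.Injective) {t : ℕ} {v w : V}
    (ht : start (Nat.log 2 (Fintype.card V)) ≤ t) (p : G.Walk v w)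
    (hj : (run G id s t v).join ≠ none) :
    (run G id s (t + 2 * Nat.log 2 (Fintype.card V) * p.length) w).join ≠ none := by
  induction p generalizing t with
  | nil => simpa using hj
  | cons h p ih =>
    have := ih (t := t + 2 * Nat.log 2 (Fintype.card V)) (by omega) (join_of_adj hid ht h hj)
    rw [SimpleGraph.Walk.length_cons]
    rwa [mul_add_one, add_comm (_ * _), ← add_assoc]

variable (G) in
/-- A bound for the round in which the last node joins the tree. -/
noncomputable def joinBound : ℕ :=
  start (Nat.log 2 (Fintype.card V)) + 2 * Nat.log 2 (Fintype.card V) * G.diam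

theorem join_all (hid : id.Injective) (hG : G.Connected) (hn : 2 ≤ Fintype.card V) {t : ℕ}
    (ht : joinBound G ≤ t) (v : V) : (run G id s t v).join ≠ none := by
  have hl : 1 ≤ Nat.log 2 (Fintype.card V) := Nat.log_pos (by norm_num) hn
  have hs : (run G id s (start (Nat.log 2 (Fintype.card V))) s).join ≠ none := by
    obtain ⟨m, hm⟩ : ∃ m, start (Nat.log 2 (Fintype.card V)) = m + 1 :=
      Nat.exists_eq_succ_of_ne_zero (by unfold start; positivity)
    have hd := done_of_start_log_le (G := G) (s := s) hid
      (le_refl (start (Nat.log 2 (Fintype.card V)))) s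
    rw [hm] at hd ⊢
    exact join_succ hd (Or.inl rfl)
  obtain ⟨p, hp⟩ := hG.exists_walk_length_eq_dist s v
  have : Nonempty V := ⟨s⟩
  have hdiam : G.dist s v ≤ G.diam := SimpleGraph.dist_le_diam
    (SimpleGraph.connected_iff_ediam_ne_top.1 hG)
  refine join_mono ?_ (join_of_walk hid le_rfl p hs)
  rw [hp]
  refine le_trans ?_ ht
  unfold joinBound
  gcongr

theorem mem_run_facts_succ {t : ℕ} {v : V} {f : Fact} : f ∈ (run G id s (t + 1) v).facts ↔
    f ∈ (run G id s t v).facts ∨ ∃ w, G.Adj w v ∧ (run G id s t w).Wants (id v) ∧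
      f ∈ (run G id s t w).facts := by
  rw [run_succ]
  simp only [State.next, State.newFacts, received, Set.mem_ofPred_eq]
  refine or_congr Iff.rfl ⟨?_, ?_⟩
  · rintro ⟨_, ⟨w, h1, rfl, h2⟩, h3⟩
    exact ⟨w, h1, h2, h3⟩
  · rintro ⟨w, h1, h2, h3⟩
    exact ⟨_, ⟨w, h1, rfl, h2⟩, h3⟩

theorem facts_sound {t : ℕ} {v : V} : (run G id s t v).facts ⊆ Set.range (fact G id s) := by
  intro f hf
  induction t generalizing v with
  | zero => exact ⟨v, Eq.symm hf⟩
  | succ t ih =>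
    rcases mem_run_facts_succ.1 hf with h | ⟨w, _, _, h⟩
    · exact ih h
    · exact ih h

theorem facts_mono {t t' : ℕ} (h : t ≤ t') (v : V) :
    (run G id s t v).facts ⊆ (run G id s t' v).facts := by
  induction t', h using Nat.le_induction with
  | base => exact subset_rfl
  | succ t' _ ih => exact ih.trans fun f hf => mem_run_facts_succ.2 (Or.inl hf)

theorem fact_mem (t : ℕ) (v : V) : fact G id s v ∈ (run G id s t v).facts :=
  facts_mono (Nat.zero_le t) v rfl

/-- Induction on the join round: the parent joined earlier, so its slot `3 * 2 ^ k - τ'` comes after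
the slot in which it receives the report. -/
theorem fact_mem_source {k : ℕ} (hk : ∀ v, (run G id s (2 ^ k) v).join ≠ none) {f : Fact} {τ : ℕ}
    {v : V} (hj : (run G id s (2 ^ k) v).join = some τ)
    (hf : f ∈ (run G id s (3 * 2 ^ k - τ) v).facts) : f ∈ (run G id s (3 * 2 ^ k) s).facts := by
  induction τ using Nat.strong_induction_on generalizing v with
  | _ τ ih =>
    by_cases hv : v = s
    · subst hv
      exact facts_mono (by omega) _ hf
    · obtain ⟨p, τ', hadj, hp, hjp, hlt⟩ := par_of_run_join hj hv
      -- Since `τ ≤ 2 ^ k`, the slot is no earlier than `2 * 2 ^ k`, when parents and join rounds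
      -- are settled.
      have hτ := (of_run_join hj).1
      have hw : (run G id s (3 * 2 ^ k - τ) v).Wants (id p) := by
        refine Or.inr (Or.inr (Or.inr (Or.inl ⟨run_par_stable (by omega) hp, τ, k,
          run_join_stable (by omega) hj, ?_⟩)))
        rw [run_time]; omega
      have h1 := (mem_run_facts_succ (t := 3 * 2 ^ k - τ) (v := p)).2
        (Or.inr ⟨v, hadj.symm, hw, hf⟩)
      exact ih τ' hlt hjp (facts_mono (by omega) _ h1)

theorem facts_source_eq {k : ℕ} (hk : ∀ v, (run G id s (2 ^ k) v).join ≠ none) :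
    (run G id s (3 * 2 ^ k) s).facts = Set.range (fact G id s) := by
  refine facts_sound.antisymm ?_
  rintro _ ⟨v, rfl⟩
  obtain ⟨τ, hτ⟩ := Option.ne_none_iff_exists'.1 (hk v)
  exact fact_mem_source hk hτ (fact_mem _ v)

theorem closed_range : Closed (Set.range (fact G id s)) := by
  rintro x N b ⟨v, hv⟩ y hy
  obtain ⟨_, h2⟩ := Prod.mk.inj hv
  obtain ⟨rfl, _⟩ := Prod.mk.inj h2
  obtain ⟨w, _, rfl⟩ := (mem_nbrs G id).1 hy
  exact ⟨_, ⟨w, rfl⟩, rfl⟩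

/-- A closed set of true facts propagates along any walk from a node it contains. This is the
source's completeness test. -/
theorem eq_range_of_closed (hid : id.Injective) (hG : G.Connected) {K : Set Fact}
    (hK : K ⊆ Set.range (fact G id s)) (hc : Closed K) {v : V} (hv : fact G id s v ∈ K) :
    K = Set.range (fact G id s) := by
  refine hK.antisymm ?_
  rintro _ ⟨w, rfl⟩
  obtain ⟨p⟩ := hG.preconnected v w
  induction p with
  | nil => exact hv
  | @cons a b _ h p ih =>
    refine ih ?_
    obtain ⟨f, hf, he⟩ := hc _ _ _ hv (id b) ((mem_nbrs G id).2 ⟨b, h, rfl⟩)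
    obtain ⟨c, rfl⟩ := hK hf
    obtain rfl : c = b := hid he
    exact hf

theorem run_fin_of_ne {t : ℕ} {v : V} (h : (run G id s t v).fin ≠ none) :
    (run G id s (t + 1) v).fin = (run G id s t v).fin := by
  rw [run_succ]
  simp [State.next, State.newFin, h]

theorem run_fin_stable {t t' : ℕ} (h : t ≤ t') {v : V} {τ : ℕ}
    (hj : (run G id s t v).fin = some τ) : (run G id s t' v).fin = some τ := by
  induction t', h using Nat.le_induction with
  | base => exact hj
  | succ t' _ ih => rw [run_fin_of_ne (by simp [ih]), ih]

theorem run_fin_source {t : ℕ} (h : (run G id s (t + 1) s).facts = Set.range (fact G id s)) :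
    (run G id s (t + 1) s).fin ≠ none := by
  by_cases h1 : (run G id s t s).fin = none
  · have h2 : Closed ((run G id s t s).newFacts (received G id (run G id s t) s)) := by
      have : (run G id s t s).newFacts (received G id (run G id s t) s) = _ := h
      rw [this]; exact closed_range
    rw [run_succ]
    simp [State.next, State.newFin, h1, h2]
  · rwa [run_fin_of_ne h1]

theorem run_fin_of_adj {t : ℕ} {v w : V} (hadj : G.Adj v w)
    (hw : (run G id s t v).Wants (id w)) (hf : (run G id s t v).fin ≠ none) :
    (run G id s (t + 1) w).fin ≠ none := by
  by_cases h1 : (run G id s t w).fin = none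
  · have h2 : ∃ p ∈ received G id (run G id s t) w, p.2.fin ≠ none :=
      ⟨_, ⟨v, hadj, rfl, hw⟩, hf⟩
    rw [run_succ]
    simp only [State.next, State.newFin, h1, if_true]
    rw [dif_pos h2]
    split_ifs
    · simp
    · exact h2.choose_spec.2
  · rwa [run_fin_of_ne h1]

/-- The value `fin` originates at the source and always travels together with the complete facts. -/
theorem of_run_fin (hid : id.Injective) (hG : G.Connected) {t : ℕ} {v : V} {τ : ℕ}
    (h : (run G id s t v).fin = some τ) : τ ≤ t ∧ (run G id s τ s).fin = some τ ∧
      (run G id s t v).facts = Set.range (fact G id s) := by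
  induction t generalizing v τ with
  | zero => exact absurd h (by simp [run, State.initial])
  | succ t ih =>
    by_cases h1 : (run G id s t v).fin = none
    · have h0 := h
      rw [run_succ] at h
      simp only [State.next, State.newFin, h1, if_true] at h
      split_ifs at h with h2 h3
      · have e : v = s := by simpa using h2.1
        subst e
        rw [run_time] at h
        obtain rfl := Option.some.inj h
        exact ⟨le_rfl, h0, eq_range_of_closed hid hG facts_sound h2.2 (fact_mem (t + 1) _)⟩
      · obtain ⟨⟨p, hadj, he, hw⟩, _⟩ := h3.choose_spec
        rw [he] at h
        obtain ⟨h4, h5, h6⟩ := ih h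
        refine ⟨by omega, h5, facts_sound.antisymm ?_⟩
        rw [← h6]
        exact fun f hf => mem_run_facts_succ.2 (Or.inr ⟨p, hadj, hw, hf⟩)
    · rw [run_fin_of_ne h1] at h
      obtain ⟨h4, h5, h6⟩ := ih h
      refine ⟨by omega, h5, facts_sound.antisymm ?_⟩
      rw [← h6]
      exact facts_mono (by omega) v

theorem exists_fin (hid : id.Injective) (hG : G.Connected) (hn : 2 ≤ Fintype.card V) :
    ∃ τ ≤ 6 * joinBound G, (run G id s τ s).fin = some τ := by
  have hl : 1 ≤ Nat.log 2 (Fintype.card V) := Nat.log_pos (by norm_num) hn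
  have h0 : joinBound G ≠ 0 := by
    have : 0 < start (Nat.log 2 (Fintype.card V)) := by unfold start; positivity
    unfold joinBound
    omega
  have h1 : joinBound G < 2 ^ (Nat.log 2 (joinBound G) + 1) :=
    Nat.lt_pow_succ_log_self (by norm_num) _
  have h2 : 2 ^ Nat.log 2 (joinBound G) ≤ joinBound G := Nat.pow_log_le_self 2 h0
  -- The power `2 ^ k` exceeds `joinBound G` but is at most twice it, so `3 * 2 ^ k` costs the
  -- factor 6.
  set k := Nat.log 2 (joinBound G) + 1 with hk
  have h3 : 2 ^ k = 2 * 2 ^ Nat.log 2 (joinBound G) := by rw [hk, pow_succ]; ring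
  have h4 := facts_source_eq (G := G) (s := s) (k := k) fun v => join_all hid hG hn h1.le v
  obtain ⟨m, hm⟩ : ∃ m, 3 * 2 ^ k = m + 1 := Nat.exists_eq_succ_of_ne_zero (by positivity)
  rw [hm] at h4
  obtain ⟨τ, hτ⟩ := Option.ne_none_iff_exists'.1 (run_fin_source h4)
  obtain ⟨h5, h6, _⟩ := of_run_fin hid hG hτ
  exact ⟨τ, by omega, h6⟩

theorem fin_unique (hid : id.Injective) (hG : G.Connected) {t t' : ℕ} {v v' : V} {τ τ' : ℕ}
    (h : (run G id s t v).fin = some τ) (h' : (run G id s t' v').fin = some τ') : τ = τ' := by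
  have h1 := (of_run_fin hid hG h).2.1
  have h2 := (of_run_fin hid hG h').2.1
  rcases le_total τ τ' with hle | hle
  · exact Option.some.inj ((run_fin_stable hle h1).symm.trans h2)
  · exact Option.some.inj (h1.symm.trans (run_fin_stable hle h2))

end Flood

/-! ### BFS trees from parent relations -/

section BFSTree

variable {V : Type*} {G : SimpleGraph V} {s : V}

/-- `P p v` says that `p` is the parent of `v` in a breadth-first search tree with root `s`. -/
structure IsParentRel (G : SimpleGraph V) (s : V) (P : V → V → Prop) : Prop where
  adj : ∀ p v, P p v → G.Adj p v
  dist_eq : ∀ p v, P p v → G.dist s v = G.dist s p + 1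
  unique : ∀ p p' v, P p v → P p' v → p = p'
  exists_parent : ∀ v, v ≠ s → ∃ p, P p v

/-- The tree given by a parent relation. -/
def treeOf (P : V → V → Prop) (hP : ∀ v, ¬ P v v) : SimpleGraph V where
  Adj v w := P v w ∨ P w v
  symm := ⟨fun _ _ h => h.symm⟩
  loopless := ⟨fun v h => hP v (or_self_iff.1 h)⟩

namespace IsParentRel

variable {P : V → V → Prop} (h : IsParentRel G s P)
include h

theorem irrefl (v : V) : ¬ P v v := fun hv => (h.adj v v hv).ne rfl

theorem exists_walk (v : V) :
    ∃ p : (treeOf P h.irrefl).Walk s v, p.length = G.dist s v := by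
  induction hd : G.dist s v generalizing v with
  | zero =>
    by_cases hv : v = s
    · subst hv
      exact ⟨SimpleGraph.Walk.nil, rfl⟩
    · obtain ⟨p, hp⟩ := h.exists_parent v hv
      have := h.dist_eq _ _ hp
      omega
  | succ d ih =>
    have hv : v ≠ s := by
      rintro rfl
      simp at hd
    obtain ⟨p, hp⟩ := h.exists_parent v hv
    have := h.dist_eq _ _ hp
    obtain ⟨q, hq⟩ := ih p (by omega)
    have hadj : (treeOf P h.irrefl).Adj p v := Or.inl hp
    exact ⟨q.concat hadj, by rw [SimpleGraph.Walk.length_concat, hq]⟩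

theorem connected : (treeOf P h.irrefl).Connected := by
  have : Nonempty V := ⟨s⟩
  refine ⟨fun u v => ?_⟩
  obtain ⟨p, _⟩ := h.exists_walk u
  obtain ⟨q, _⟩ := h.exists_walk v
  exact ⟨p.reverse.append q⟩

theorem le : treeOf P h.irrefl ≤ G := by
  rintro v w (hvw | hvw)
  · exact h.adj _ _ hvw
  · exact (h.adj _ _ hvw).symm

theorem treeOf_dist_eq (v : V) : (treeOf P h.irrefl).dist s v = G.dist s v := by
  apply le_antisymm
  · obtain ⟨p, hp⟩ := h.exists_walk v
    rw [← hp]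
    exact SimpleGraph.dist_le p
  · obtain ⟨p, hp⟩ := h.connected.exists_walk_length_eq_dist s v
    rw [← hp, ← SimpleGraph.Walk.length_mapLe h.le p]
    exact SimpleGraph.dist_le _

/-- Sending each non-root node to its parent edge hits all edges, so a connected graph has at most
`n - 1` edges and is a tree. -/
theorem isTree [Finite V] : (treeOf P h.irrefl).IsTree := by
  classical
  rw [SimpleGraph.isTree_iff_connected_and_card]
  refine ⟨h.connected, le_antisymm ?_ h.connected.card_vert_le_card_edgeSet_add_one⟩
  have hex : ∀ v : {v // v ≠ s}, ∃ p, P p v := fun v => h.exists_parent v v.2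
  choose f hf using hex
  have hsurj : Function.Surjective
      (fun v : {v // v ≠ s} => (⟨s(f v, v), Or.inl (hf v)⟩ : (treeOf P h.irrefl).edgeSet)) := by
    rintro ⟨e, he⟩
    induction e using Sym2.ind with
    | _ a b =>
      have key : ∀ a b, P a b → ∃ v : {v // v ≠ s}, s(f v, v.1) = s(a, b) := by
        intro a b hab
        have hb : b ≠ s := by
          rintro rfl
          have := h.dist_eq _ _ hab
          simp at this
        exact ⟨⟨b, hb⟩, by rw [h.unique _ _ _ (hf ⟨b, hb⟩) hab]⟩
      rcases he with hab | hab
      · obtain ⟨v, hv⟩ := key a b hab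
        exact ⟨v, Subtype.ext hv⟩
      · obtain ⟨v, hv⟩ := key b a hab
        exact ⟨v, Subtype.ext (hv.trans Sym2.eq_swap)⟩
  have h1 : Nat.card (treeOf P h.irrefl).edgeSet ≤ Nat.card {v // v ≠ s} :=
    Nat.card_le_card_of_surjective _ hsurj
  have h2 : Nat.card {v // v ≠ s} < Nat.card V :=
    Finite.card_subtype_lt (x := s) (by simp)
  omega

theorem isBFSTree [Finite V] : KT1.IsBFSTree G (treeOf P h.irrefl) s :=
  ⟨h.le, h.isTree, h.treeOf_dist_eq⟩

theorem isParent_iff (v p : V) : KT1.IsParent (treeOf P h.irrefl) s v p ↔ P p v := by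
  unfold KT1.IsParent
  rw [h.treeOf_dist_eq, h.treeOf_dist_eq]
  constructor
  · rintro ⟨hvp | hvp, hd⟩
    · have := h.dist_eq _ _ hvp
      omega
    · exact hvp
  · exact fun hp => ⟨Or.inr hp, h.dist_eq _ _ hp⟩

end IsParentRel

theorem exists_adj_dist_eq (hG : G.Connected) {v : V} (hv : v ≠ s) :
    ∃ p, G.Adj p v ∧ G.dist s v = G.dist s p + 1 := by
  obtain ⟨q, hq⟩ := hG.exists_walk_length_eq_dist v s
  cases q with
  | nil => exact absurd rfl hv
  | @cons _ p _ hadj q =>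
    refine ⟨p, hadj.symm, ?_⟩
    have h1 := SimpleGraph.dist_le q
    obtain ⟨q', hq'⟩ := hG.exists_walk_length_eq_dist p s
    have h2 := SimpleGraph.dist_le (SimpleGraph.Walk.cons hadj q')
    rw [SimpleGraph.Walk.length_cons] at hq h2
    rw [SimpleGraph.dist_comm, SimpleGraph.dist_comm (u := s)]
    omega

end BFSTree

/-! ### Complete facts determine distances and the BFS tree; the broadcast -/

section Facts

variable {V : Type*} [Fintype V] [DecidableEq V] {G : SimpleGraph V} [DecidableRel G.Adj]
  {id : V → ℕ} {s : V}

theorem mem_range_fact {x : ℕ} {N : Finset ℕ} {b : Bool} :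
    (x, N, b) ∈ Set.range (fact G id s) ↔
      ∃ v, id v = x ∧ (G.neighborFinset v).image id = N ∧ decide (v = s) = b := by
  simp only [Set.mem_range, fact, Prod.mk.injEq]

theorem walkTo_iff (hid : id.Injective) (k : ℕ) (v : V) :
    WalkTo (Set.range (fact G id s)) k (id v) ↔ ∃ p : G.Walk v s, p.length = k := by
  induction k generalizing v with
  | zero =>
    constructor
    · rintro ⟨N, hN⟩
      obtain ⟨w, hw, _, hs⟩ := mem_range_fact.1 hN
      obtain rfl := hid hw
      obtain rfl : w = s := by simpa using hs
      exact ⟨SimpleGraph.Walk.nil, rfl⟩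
    · rintro ⟨p, hp⟩
      obtain rfl := SimpleGraph.Walk.eq_of_length_eq_zero hp
      exact ⟨_, mem_range_fact.2 ⟨v, rfl, rfl, by simp⟩⟩
  | succ k ih =>
    constructor
    · rintro ⟨y, N, b, hN, hv, hw⟩
      obtain ⟨w, rfl, rfl, _⟩ := mem_range_fact.1 hN
      obtain ⟨v', hadj, he⟩ := (mem_nbrs G id).1 hv
      obtain rfl := hid he
      obtain ⟨p, hp⟩ := (ih w).1 hw
      exact ⟨SimpleGraph.Walk.cons hadj.symm p, by simp [hp]⟩
    · rintro ⟨p, hp⟩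
      cases p with
      | nil => simp at hp
      | @cons _ w _ hadj p =>
        exact ⟨id w, _, _, mem_range_fact.2 ⟨w, rfl, rfl, rfl⟩,
          (mem_nbrs G id).2 ⟨v, hadj.symm, rfl⟩, (ih w).2 ⟨p, by simpa using hp⟩⟩

theorem depth_eq (hid : id.Injective) (v : V) :
    depth (Set.range (fact G id s)) (id v) = G.dist s v := by
  rw [SimpleGraph.dist_comm, SimpleGraph.dist_eq_sInf, depth]
  congr 1
  ext k
  exact walkTo_iff hid k v

variable (G id s) in
/-- The node `p` is the parent of `v` in the tree that all nodes compute in the end. -/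
def Parent (p v : V) : Prop := treeParent (Set.range (fact G id s)) (id v) = some (id p)

theorem of_treeParent (hid : id.Injective) {v : V} {x : ℕ}
    (h : treeParent (Set.range (fact G id s)) (id v) = some x) :
    ∃ p, id p = x ∧ G.Adj p v ∧ G.dist s v = G.dist s p + 1 := by
  unfold treeParent at h
  split_ifs at h with h1
  obtain ⟨⟨N, b, hN, hv⟩, hd⟩ := h1.choose_spec
  rw [Option.some.inj h] at hN hd
  obtain ⟨p, rfl, rfl, _⟩ := mem_range_fact.1 hN
  obtain ⟨v', hadj, he⟩ := (mem_nbrs G id).1 hv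
  obtain rfl := hid he
  rw [depth_eq hid, depth_eq hid] at hd
  exact ⟨p, rfl, hadj, hd⟩

theorem isParentRel (hid : id.Injective) (hG : G.Connected) :
    IsParentRel G s (Parent G id s) where
  adj p v h := by
    obtain ⟨p', he, hadj, _⟩ := of_treeParent hid h
    obtain rfl := hid he
    exact hadj
  dist_eq p v h := by
    obtain ⟨p', he, _, hd⟩ := of_treeParent hid h
    obtain rfl := hid he
    exact hd
  unique p p' v h h' := hid (Option.some.inj (h.symm.trans h'))
  exists_parent v hv := by
    obtain ⟨p, hadj, hd⟩ := exists_adj_dist_eq hG hv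
    have h1 : ∃ y, (∃ N b, (y, N, b) ∈ Set.range (fact G id s) ∧ id v ∈ N) ∧
        depth (Set.range (fact G id s)) (id v) = depth (Set.range (fact G id s)) y + 1 :=
      ⟨id p, ⟨_, _, mem_range_fact.2 ⟨p, rfl, rfl, rfl⟩, (mem_nbrs G id).2 ⟨v, hadj, rfl⟩⟩, by
        rw [depth_eq hid, depth_eq hid, hd]⟩
    have h2 : treeParent (Set.range (fact G id s)) (id v) = some h1.choose := by
      unfold treeParent
      rw [dif_pos h1]
    obtain ⟨p', he, _⟩ := of_treeParent hid h2
    exact ⟨p', by rw [Parent, h2, he]⟩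

theorem bddAbove_depths (hid : id.Injective) (hG : G.Connected) :
    G.diam ∈ upperBounds {k | ∃ f ∈ Set.range (fact G id s),
      depth (Set.range (fact G id s)) f.1 = k} := by
  have : Nonempty V := ⟨s⟩
  rintro _ ⟨_, ⟨v, rfl⟩, rfl⟩
  refine le_trans (depth_eq hid v).le ?_
  exact SimpleGraph.dist_le_diam (SimpleGraph.connected_iff_ediam_ne_top.1 hG)

theorem dist_le_height (hid : id.Injective) (hG : G.Connected) (v : V) :
    G.dist s v ≤ height (Set.range (fact G id s)) :=
  le_csSup ⟨_, bddAbove_depths hid hG⟩ ⟨_, ⟨v, rfl⟩, depth_eq hid v⟩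

theorem height_le_diam (hid : id.Injective) (hG : G.Connected) :
    height (Set.range (fact G id s)) ≤ G.diam :=
  csSup_le ⟨_, _, ⟨s, rfl⟩, rfl⟩ (bddAbove_depths hid hG)

/-- A node at depth `d` is informed by round `τ + d`, exactly the round in which it serves its tree
children. -/
theorem run_fin_of_dist (hid : id.Injective) (hG : G.Connected) {τ : ℕ}
    (hτ : (run G id s τ s).fin = some τ) (v : V) :
    (run G id s (τ + G.dist s v) v).fin = some τ := by
  induction hd : G.dist s v generalizing v with
  | zero =>
    obtain rfl := hG.dist_eq_zero_iff.1 hd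
    exact hτ
  | succ d ih =>
    have hv : v ≠ s := by
      rintro rfl
      simp at hd
    have hP := isParentRel (G := G) (s := s) hid hG
    obtain ⟨p, hp⟩ := hP.exists_parent v hv
    have hdp := hP.dist_eq _ _ hp
    have hfin := ih p (by omega)
    have hfacts := (of_run_fin hid hG hfin).2.2
    have hw : (run G id s (τ + d) p).Wants (id v) := by
      refine Or.inr (Or.inr (Or.inr (Or.inr ⟨τ, hfin, ?_, ?_⟩)))
      · rw [hfacts, run_own, run_time, depth_eq hid]; omega
      · rw [hfacts, run_own]; exact hp
    obtain ⟨τ', hτ'⟩ := Option.ne_none_iff_exists'.1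
      (run_fin_of_adj (hP.adj _ _ hp) hw (by rw [hfin]; simp))
    rw [← add_assoc, hτ', fin_unique hid hG hτ' hτ]

theorem run_fin_of_height_le (hid : id.Injective) (hG : G.Connected) {τ t : ℕ}
    (hτ : (run G id s τ s).fin = some τ) (ht : τ + height (Set.range (fact G id s)) ≤ t) (v : V) :
    (run G id s t v).fin = some τ :=
  run_fin_stable ((Nat.add_le_add_left (dist_le_height hid hG v) τ).trans ht)
    (run_fin_of_dist hid hG hτ v)

end Facts

/-! ### Simultaneous termination, message and round bounds -/

section Counting

variable {V : Type*} [Fintype V] [DecidableEq V] {G : SimpleGraph V} [DecidableRel G.Adj]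
  {id : V → ℕ} {s : V}

variable (G id s) in
/-- The round in which all nodes terminate, if the source knows the whole graph in round `τ`. -/
noncomputable def lastRound (τ : ℕ) : ℕ := τ + height (Set.range (fact G id s))

open Classical in
variable (G id s) in
/-- The output of the node `v`. -/
noncomputable def result (v : V) : KT1.TreeOutput :=
  ⟨treeParent (Set.range (fact G id s)) (id v), ((G.neighborFinset v).image id).filter fun c =>
    treeParent (Set.range (fact G id s)) c = some (id v)⟩

omit [DecidableEq V] in
theorem nbrs_ne_empty (hG : G.Connected) (hn : 2 ≤ Fintype.card V) (v : V) :
    (G.neighborFinset v).image id ≠ ∅ := by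
  have : Nontrivial V := Fintype.one_lt_card_iff_nontrivial.1 hn
  obtain ⟨w, hw⟩ := hG.preconnected.exists_adj_of_nontrivial v
  exact Finset.ne_empty_of_mem ((mem_nbrs G id).2 ⟨w, hw, rfl⟩)

/-- Nodes are informed at different times, but all with the same `τ` and the same height, so no one
stops before the common last round. -/
theorem output_eq_none (hid : id.Injective) (hG : G.Connected) (hn : 2 ≤ Fintype.card V)
    {τ t : ℕ} (hτ : (run G id s τ s).fin = some τ) (ht : t < lastRound G id s τ) (v : V) :
    algorithm.output (run G id s t v) = none := by
  simp only [algorithm, run_nbrs, if_neg (nbrs_ne_empty hG hn v), run_time]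
  rcases hf : (run G id s t v).fin with _ | τ'
  · rfl
  · have h1 := (of_run_fin hid hG hf).2.2
    obtain rfl := fin_unique hid hG hf hτ
    simp only [h1]
    exact if_neg (not_le.2 ht)

theorem output_lastRound (hid : id.Injective) (hG : G.Connected) (hn : 2 ≤ Fintype.card V)
    {τ : ℕ} (hτ : (run G id s τ s).fin = some τ) (v : V) :
    algorithm.output (run G id s (lastRound G id s τ) v) = some (result G id s v) := by
  have hf := run_fin_of_height_le hid hG hτ (le_refl (lastRound G id s τ)) v
  have h1 := (of_run_fin hid hG hf).2.2
  simp only [algorithm, run_nbrs, if_neg (nbrs_ne_empty hG hn v), run_time, hf, h1, run_own]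
  exact if_pos le_rfl

theorem sent_run {t : ℕ} {v w : V} (h : algorithm.output (run G id s t v) = none) :
    algorithm.sent id (run G id s t) v w =
      (algorithm.send (run G id s t v) (id w) : Option State) := by
  unfold KT1.LocalAlgorithm.sent
  rw [h]

open Classical in
theorem send_eq (σ : State) (x : ℕ) :
    (algorithm.send σ x : Option State) = if σ.Wants x then some σ else none := rfl

/-- With no early termination, the rule silencing terminated nodes never acts, and the idealised run
is the real execution. -/
theorem config_eq (hid : id.Injective) (hG : G.Connected) (hn : 2 ≤ Fintype.card V)
    {τ : ℕ} (hτ : (run G id s τ s).fin = some τ) {t : ℕ} (ht : t ≤ lastRound G id s τ) :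
    algorithm.config G id s t = run G id s t := by
  induction t with
  | zero => rfl
  | succ t ih =>
    have hout := output_eq_none hid hG hn hτ (t := t) (by omega)
    funext v
    change algorithm.round G id (algorithm.config G id s t) v = _
    rw [ih (by omega), run_succ]
    unfold KT1.LocalAlgorithm.round
    rw [hout v]
    change State.next _ _ = _
    congr 1
    ext ⟨x, σ⟩
    constructor
    · rintro ⟨w, hadj, h1, h2⟩
      rw [sent_run (hout w), send_eq] at h2
      split_ifs at h2 with h3
      exact ⟨w, hadj, Prod.ext h1 (Option.some.inj h2).symm, h3⟩
    · rintro ⟨w, hadj, h1, h2⟩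
      obtain ⟨rfl, rfl⟩ := Prod.mk.inj h1
      refine ⟨w, hadj, rfl, ?_⟩
      rw [sent_run (hout w), send_eq, if_pos h2]
      rfl

theorem describes_result (hid : id.Injective) (hG : G.Connected) :
    KT1.Describes (result G id s) (treeOf (Parent G id s) (isParentRel hid hG).irrefl) id s := by
  have hP := isParentRel (G := G) (s := s) hid hG
  intro v
  simp only [hP.isParent_iff]
  constructor
  · intro k
    constructor
    · intro hk
      obtain ⟨p, rfl, _⟩ := of_treeParent hid hk
      exact ⟨p, hk, rfl⟩
    · rintro ⟨p, hp, rfl⟩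
      exact hp
  · intro k
    simp only [result, Finset.mem_filter, mem_nbrs]
    constructor
    · rintro ⟨⟨c, _, rfl⟩, hc⟩
      exact ⟨c, hc, rfl⟩
    · rintro ⟨c, hc, rfl⟩
      exact ⟨⟨c, hP.adj _ _ hc, rfl⟩, hc⟩

theorem lt_start_log_of_near (hid : id.Injective) {t : ℕ} {v : V}
    (h : (run G id s t v).near.Nonempty) : t < start (Nat.log 2 (Fintype.card V)) := by
  obtain ⟨x, hx⟩ := h
  rw [(gossipInv hid t v).near_eq] at hx
  obtain ⟨u, _, ha, _⟩ := hx
  have := (isGossip hid).lt_log_of_active ha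
  by_contra h1
  have := le_ph_iff.2 (not_lt.1 h1)
  omega

theorem messageCount_le (hid : id.Injective) (hG : G.Connected) (hn : 2 ≤ Fintype.card V)
    {τ κ : ℕ} (hτ : (run G id s τ s).fin = some τ) (hκ : lastRound G id s τ ≤ 2 ^ κ) :
    algorithm.messageCount G id s (lastRound G id s τ) ≤
      (2 * start (Nat.log 2 (Fintype.card V)) + 2 * Nat.log 2 (Fintype.card V) + κ + 1) *
        Fintype.card V := by
  classical
  have : Nonempty V := ⟨s⟩
  set T := lastRound G id s τ
  set l := Nat.log 2 (Fintype.card V)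
  have hg := isGossip (G := G) (s := s) hid
  -- The defaults in `getD 0` below are harmless: they only add spurious elements to the covering
  -- sets.
  let g : ℕ → V := Function.invFun id
  have hgid : ∀ v, g (id v) = v := Function.leftInverse_invFun hid
  let lk : ℕ → V → V := fun j v => g (((run G id s (start j) v).link j).getD 0)
  have hlk : ∀ j v w, Link G id s j v w → lk j v = w := by
    intro j v w h
    unfold Link at h
    simp only [lk, h, Option.getD_some, hgid]
  let jt : V → ℕ := fun v => (run G id s T v).join.getD 0
  have hjt : ∀ t ≤ T, ∀ v a, (run G id s t v).join = some a → jt v = a := by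
    intro t ht v a h
    simp only [jt, run_join_stable ht h, Option.getD_some]
  -- Each set covers one kind of message by a charging: gossip (`F1`, `F2`) to the round and the
  -- link's opener, flooding (`F3`, `F4`) to the label and the opener, reports (`F5`) to the
  -- exponent and the sender, broadcast (`F6`) to the child.
  let F1 : Finset (Σ _ : ℕ, V × V) := (Finset.range (start l) ×ˢ Finset.univ).image
    fun p => ⟨p.1, (p.2, lk (ph p.1 - ps p.1) p.2)⟩
  let F2 : Finset (Σ _ : ℕ, V × V) := (Finset.range (start l) ×ˢ Finset.univ).image
    fun p => ⟨p.1, (lk (ps p.1 - (ph p.1 + 1)) p.2, p.2)⟩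
  let F3 : Finset (Σ _ : ℕ, V × V) := (Finset.range l ×ˢ Finset.univ).image
    fun p => ⟨jt p.2, (p.2, lk p.1 p.2)⟩
  let F4 : Finset (Σ _ : ℕ, V × V) := (Finset.range l ×ˢ Finset.univ).image
    fun p => ⟨jt (lk p.1 p.2), (lk p.1 p.2, p.2)⟩
  let F5 : Finset (Σ _ : ℕ, V × V) := (Finset.range κ ×ˢ Finset.univ).image
    fun p => ⟨3 * 2 ^ p.1 - jt p.2, (p.2, g ((run G id s T p.2).par.getD 0))⟩
  let F6 : Finset (Σ _ : ℕ, V × V) := Finset.univ.image fun c =>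
    let p := g ((treeParent (Set.range (fact G id s)) (id c)).getD 0)
    ⟨τ + G.dist s p, (p, c)⟩
  unfold KT1.LocalAlgorithm.messageCount
  rw [← Finset.card_sigma]
  have hsub : ((Finset.range T).sigma fun t => Finset.univ.filter fun e : V × V => G.Adj e.1 e.2 ∧
      (algorithm.sent id (algorithm.config G id s t) e.1 e.2).isSome = true) ⊆
      F1 ∪ (F2 ∪ (F3 ∪ (F4 ∪ (F5 ∪ F6)))) := by
    rintro ⟨t, v, w⟩ hm
    simp only [Finset.mem_sigma, Finset.mem_range, Finset.mem_filter, Finset.mem_univ,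
      true_and] at hm
    obtain ⟨ht, hadj, hs⟩ := hm
    rw [config_eq hid hG hn hτ ht.le, sent_run (output_eq_none hid hG hn hτ ht v), send_eq] at hs
    have hw : (run G id s t v).Wants (id w) := by
      by_contra hw
      rw [if_neg hw] at hs
      exact Bool.false_ne_true hs
    have hlt := ps_lt t
    have hI := gossipInv (G := G) (s := s) hid t
    simp only [Finset.mem_union]
    rcases hw with ⟨hp, hlink, hne⟩ | ⟨hp, hin, hne⟩ | ⟨hj, j, hjp, hlink⟩ |
      ⟨hpar, a, k, hj, hk⟩ | ⟨τ', hf, he, hc⟩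
    · left
      rw [run_time] at hp hlink
      refine Finset.mem_image.2 ⟨(t, v), ?_, ?_⟩
      · simpa using lt_start_log_of_near hid hne
      · simp only [hlk _ _ _ (((hI v).link_iff (Nat.sub_le _ _) w).1 hlink)]
    · right; left
      rw [run_time] at hp hin
      obtain ⟨w', _, hw', hL⟩ := (hI v).inl_sound _ _ hin
      obtain rfl := hid hw'
      refine Finset.mem_image.2 ⟨(t, w), ?_, ?_⟩
      · simpa using lt_start_log_of_near hid hne
      · simp only [hlk _ _ _ hL]
    · rw [run_time] at hj hjp
      have hjv := hjt t ht.le v t hj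
      rcases hlink with hlink | hin
      · right; right; left
        have hL := ((hI v).link_iff hjp w).1 hlink
        refine Finset.mem_image.2 ⟨(j, v), ?_, ?_⟩
        · simpa using hg.lt_log_of_active ⟨w, hL⟩
        · simp only [hlk _ _ _ hL, hjv]
      · right; right; right; left
        obtain ⟨w', _, hw', hL⟩ := (hI v).inl_sound _ _ hin
        obtain rfl := hid hw'
        refine Finset.mem_image.2 ⟨(j, w), ?_, ?_⟩
        · simpa using hg.lt_log_of_active ⟨v, hL⟩
        · simp only [hlk _ _ _ hL, hjv]
    · right; right; right; right; left
      rw [run_time] at hk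
      have hjv := hjt t ht.le v a hj
      have ha := (of_run_join hj).1
      refine Finset.mem_image.2 ⟨(k, v), ?_, ?_⟩
      -- From `t + a = 3 * 2 ^ k`, `a ≤ t` and `t < T ≤ 2 ^ κ`.
      · have : 2 ^ k < 2 ^ κ := by omega
        simpa using (Nat.pow_lt_pow_iff_right (by norm_num)).1 this
      · have e : 3 * 2 ^ k - a = t := by omega
        simp only [run_par_stable ht.le hpar, Option.getD_some, hgid, hjv, e]
    · right; right; right; right; right
      obtain ⟨_, _, hfacts⟩ := of_run_fin hid hG hf
      obtain rfl := fin_unique hid hG hf hτ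
      rw [hfacts, run_own] at hc he
      rw [run_time, depth_eq hid] at he
      refine Finset.mem_image.2 ⟨w, Finset.mem_univ _, ?_⟩
      simp only [hc, Option.getD_some, hgid, he]
  refine (Finset.card_le_card hsub).trans ?_
  have c1 : F1.card ≤ start l * Fintype.card V := Finset.card_image_le.trans (by simp)
  have c2 : F2.card ≤ start l * Fintype.card V := Finset.card_image_le.trans (by simp)
  have c3 : F3.card ≤ l * Fintype.card V := Finset.card_image_le.trans (by simp)
  have c4 : F4.card ≤ l * Fintype.card V := Finset.card_image_le.trans (by simp)
  have c5 : F5.card ≤ κ * Fintype.card V := Finset.card_image_le.trans (by simp)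
  have c6 : F6.card ≤ Fintype.card V := Finset.card_image_le.trans (by simp)
  have u1 := Finset.card_union_le F1 (F2 ∪ (F3 ∪ (F4 ∪ (F5 ∪ F6))))
  have u2 := Finset.card_union_le F2 (F3 ∪ (F4 ∪ (F5 ∪ F6)))
  have u3 := Finset.card_union_le F3 (F4 ∪ (F5 ∪ F6))
  have u4 := Finset.card_union_le F4 (F5 ∪ F6)
  have u5 := Finset.card_union_le F5 F6
  linarith

omit [DecidableRel G.Adj] [DecidableEq V] in
theorem diam_lt_card (hG : G.Connected) : G.diam < Fintype.card V := by
  have := hG.nonempty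
  obtain ⟨u, v, huv⟩ := G.exists_dist_eq_diam
  obtain ⟨p, hp, hl⟩ := hG.exists_path_of_dist u v
  rw [← huv, ← hl]
  exact hp.length_lt

theorem lastRound_le (hid : id.Injective) (hG : G.Connected) {τ : ℕ} (hτ : τ ≤ 6 * joinBound G) :
    lastRound G id s τ ≤ 6 * (start (Nat.log 2 (Fintype.card V)) +
      2 * Nat.log 2 (Fintype.card V) * G.diam) + G.diam :=
  Nat.add_le_add hτ (height_le_diam hid hG)

theorem lastRound_le_two_pow (hid : id.Injective) (hG : G.Connected) {τ : ℕ}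
    (hτ : τ ≤ 6 * joinBound G) :
    lastRound G id s τ ≤ 2 ^ (2 * Nat.log 2 (Fintype.card V) + 5) := by
  refine (lastRound_le hid hG hτ).trans ?_
  have h1 := diam_lt_card hG
  have h2 : Fintype.card V < 2 ^ (Nat.log 2 (Fintype.card V) + 1) :=
    Nat.lt_pow_succ_log_self (by norm_num) _
  have h3 : Nat.log 2 (Fintype.card V) < 2 ^ Nat.log 2 (Fintype.card V) := Nat.lt_two_pow_self
  unfold start
  set l := Nat.log 2 (Fintype.card V)
  rw [pow_succ] at h2
  -- With `X = 2 ^ l` the bound is at most `6 * (X² + 4 * X²) + 2 * X ≤ 32 * X²`.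
  have e : 2 ^ (2 * l + 5) = 32 * (2 ^ l * 2 ^ l) := by ring
  rw [e]
  set X := 2 ^ l
  have h4 : G.diam ≤ 2 * X := by omega
  have h5 : l * (l + 1) ≤ X * X := Nat.mul_le_mul h3.le h3
  have h6 : l * G.diam ≤ X * (2 * X) := Nat.mul_le_mul h3.le h4
  have h7 : X * 1 ≤ X * X := Nat.mul_le_mul_left X (by omega)
  nlinarith

theorem log_two_card_le (V : Type*) [Fintype V] [Nonempty V] :
    (Nat.log 2 (Fintype.card V) : ℝ) ≤ 2 * Real.log (Fintype.card V) := by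
  have h0 : 0 < Fintype.card V := Fintype.card_pos
  have h1 : ((2 ^ Nat.log 2 (Fintype.card V) : ℕ) : ℝ) ≤ Fintype.card V := by
    exact_mod_cast Nat.pow_log_le_self 2 h0.ne'
  have h2 := Real.log_le_log (by positivity) h1
  rw [Nat.cast_pow, Real.log_pow, Nat.cast_ofNat] at h2
  have h3 : (1 / 2 : ℝ) ≤ Real.log 2 := by
    have := Real.log_two_gt_d9
    linarith
  have h4 : (0 : ℝ) ≤ Nat.log 2 (Fintype.card V) := by positivity
  have h5 := mul_le_mul_of_nonneg_left h3 h4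
  linarith

theorem exists_run_of_two_le (hid : id.Injective) (hG : G.Connected) (hn : 2 ≤ Fintype.card V) :
    ∃ T, algorithm.FinishesWithin G id s T (result G id s) ∧
      (T : ℝ) ≤ 56 * ((G.diam : ℝ) * Real.log (Fintype.card V : ℝ) +
        Real.log (Fintype.card V : ℝ) ^ 2) ∧
      (algorithm.messageCount G id s T : ℝ) ≤
        56 * ((Fintype.card V : ℝ) * Real.log (Fintype.card V : ℝ) ^ 2) := by
  have : Nonempty V := ⟨s⟩
  obtain ⟨τ, hle, hτ⟩ := exists_fin (s := s) hid hG hn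
  have hT := lastRound_le (s := s) hid hG hle
  have hM := messageCount_le hid hG hn hτ (lastRound_le_two_pow hid hG hle)
  have hlog := log_two_card_le V
  have hl : 1 ≤ Nat.log 2 (Fintype.card V) := Nat.log_pos (by norm_num) hn
  refine ⟨lastRound G id s τ, fun v => ?_, ?_, ?_⟩
  · rw [config_eq hid hG hn hτ le_rfl]
    exact output_lastRound hid hG hn hτ v
  · unfold start at hT
    set l := Nat.log 2 (Fintype.card V)
    have h1 : lastRound G id s τ ≤ 12 * l ^ 2 + 13 * (G.diam * l) := by nlinarith
    have h2 : (lastRound G id s τ : ℝ) ≤ 12 * (l : ℝ) ^ 2 + 13 * (G.diam * l) := by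
      exact_mod_cast h1
    have h3 : (l : ℝ) ^ 2 ≤ (2 * Real.log (Fintype.card V)) ^ 2 := by gcongr
    have h4 : (G.diam : ℝ) * l ≤ G.diam * (2 * Real.log (Fintype.card V)) := by gcongr
    have h5 : 0 ≤ (G.diam : ℝ) * l := by positivity
    nlinarith [sq_nonneg (Real.log (Fintype.card V))]
  · unfold start at hM
    set l := Nat.log 2 (Fintype.card V)
    have h1 : 2 * (l * (l + 1)) + 2 * l + (2 * l + 5) + 1 ≤ 14 * l ^ 2 := by nlinarith
    have h2 := hM.trans (Nat.mul_le_mul_right _ h1)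
    have h3 : (algorithm.messageCount G id s (lastRound G id s τ) : ℝ) ≤
        14 * (l : ℝ) ^ 2 * Fintype.card V := by exact_mod_cast h2
    have h4 : (l : ℝ) ^ 2 ≤ (2 * Real.log (Fintype.card V)) ^ 2 := by gcongr
    have h5 : (l : ℝ) ^ 2 * Fintype.card V ≤
        (2 * Real.log (Fintype.card V)) ^ 2 * Fintype.card V := by gcongr
    nlinarith

theorem finishesWithin_zero [Subsingleton V] (hid : id.Injective) :
    algorithm.FinishesWithin G id s 0 (result G id s) := by
  intro v
  have hN : (G.neighborFinset v).image id = ∅ := by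
    refine Finset.eq_empty_of_forall_notMem fun x hx => ?_
    obtain ⟨w, hw, _⟩ := (mem_nbrs G id).1 hx
    exact hw.ne (Subsingleton.elim _ _)
  have hP : treeParent (Set.range (fact G id s)) (id v) = none := by
    by_contra h
    obtain ⟨x, hx⟩ := Option.ne_none_iff_exists'.1 h
    obtain ⟨p, _, hp, _⟩ := of_treeParent hid hx
    exact hp.ne (Subsingleton.elim _ _)
  have h1 : result G id s v = ⟨none, ∅⟩ := by
    unfold result
    rw [hP, hN, Finset.filter_empty]
  rw [h1]
  exact if_pos hN

end Counting

end GossipBFS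

theorem mainTheorem2 :
    ∃ (A : KT1.LocalAlgorithm KT1.TreeOutput) (C : ℝ),
      ∀ (V : Type*) [Fintype V] [DecidableEq V] (G : SimpleGraph V) [DecidableRel G.Adj]
        (id : V → ℕ) (s : V), G.Connected → Function.Injective id →
        ∃ (T : ℕ) (o : V → KT1.TreeOutput) (B : SimpleGraph V),
          A.FinishesWithin G id s T o ∧
          KT1.IsBFSTree G B s ∧
          KT1.Describes o B id s ∧
          (T : ℝ) ≤ C * ((G.diam : ℝ) * Real.log (Fintype.card V : ℝ) +
            Real.log (Fintype.card V : ℝ) ^ 2) ∧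
          (A.messageCount G id s T : ℝ) ≤
            C * ((Fintype.card V : ℝ) * Real.log (Fintype.card V : ℝ) ^ 2) := by
  -- Here 56 is `14 * 2²`: the message count is at most `14 (log₂ n)² n`, and `log₂ n ≤ 2 log n`
  -- with the floor of `log₂ n`. The round bound needs less.
  refine ⟨GossipBFS.algorithm, 56, ?_⟩
  intro V _ _ G _ id s hG hid
  have hB := (GossipBFS.isParentRel (G := G) (s := s) hid hG).isBFSTree
  have hD := GossipBFS.describes_result (G := G) (s := s) hid hG
  -- For a single node both bounds are 0, so it must stop before the first round.
  rcases Nat.lt_or_ge (Fintype.card V) 2 with hn | hn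
  · have hsub : Subsingleton V := Fintype.card_le_one_iff_subsingleton.1 (by omega)
    have hc : Fintype.card V = 1 := Fintype.card_eq_one_iff.2 ⟨s, fun v => Subsingleton.elim _ _⟩
    refine ⟨0, _, _, GossipBFS.finishesWithin_zero hid, hB, hD, ?_, ?_⟩
    · simp [hc]
    · simp [hc, KT1.LocalAlgorithm.messageCount]
  · obtain ⟨T, h1, h2, h3⟩ := GossipBFS.exists_run_of_two_le (s := s) hid hG hn
    exact ⟨T, _, _, h1, hB, hD, h2, h3⟩
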